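/- Very few (top) samples matter. A seller sells one item to $n$ buyers whose nonnegative values $v_1,\dots,v_n$ are drawn independently, $v_i\sim D_i$, where each $D_i$ is an arbitrary probability distribution on $[0,\infty)$; write $\boldsymbol D=D_1\times\cdots\times D_n$. A (direct, possibly randomized) mechanism maps each bid profile $\boldsymbol b\in[0,\infty)^n$ to allocation probabilities $x_i(\boldsymbol b)\ge 0$ with $\sum_i x_i(\boldsymbol b)\le 1$ and to real payments $p_i(\boldsymbol b)$. It is DSIC and IR if, for every buyer $i$, every value $v_i\ge 0$ and all bids of the other buyers, the utility $v_i x_i-p_i$ of buyer $i$ is maximized by the bid $b_i=v_i$ and is then nonnegative. Let $\mathrm{OPT}(\boldsymbol D)\in[0,\infty]$ be the supremum of the expected revenue $\mathbf E_{\boldsymbol v\sim\boldsymbol D}\big[\sum_i p_i(\boldsymbol v)\big]$ over all DSIC and IR mechanisms for which this expectation is defined. The quantile of a value $v$ with respect to a distribution $D$ is $q^D(v)=\Pr_{x\sim D}[x\ge v]$. For $0\le\theta\le1$, let $D_\theta$ be the distribution obtained from $D$ by rounding values of quantile greater than $\theta$ down to $0$, i.e. the distribution with $q^{D_\theta}(v)=\min\{q^D(v),\theta\}$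 for $v>0$ and $q^{D_\theta}(0)=1$. For $\boldsymbol\theta\in[0,1]^n$ let $\boldsymbol D_{\boldsymbol\theta}=(D_1)_{\theta_1}\times\cdots\times(D_n)_{\theta_n}$. **Lemma.** For every $0<\varepsilon\le 1$ and every product distribution $\boldsymbol D$ as above, there is a vector $\boldsymbol\theta\in[0,1]^n$ of thresholds such that 1. $\sum_{i=1}^n\theta_i\le\ln\frac1\varepsilon+1$, and 2. $\mathrm{OPT}(\boldsymbol D_{\boldsymbol\theta})\ge(1-\varepsilon)\,\mathrm{OPT}(\boldsymbol D)$. If moreover every $D_i$ is supported in $[0,1]$, the same $\boldsymbol\theta$ satisfies $\mathrm{OPT}(\boldsymbol D_{\boldsymbol\theta})\ge\mathrm{OPT}(\boldsymbol D)-\varepsilon$. (When $\mathrm{OPT}(\boldsymbol D)=\infty$ and $\varepsilon<1$, part 2 says that $\mathrm{OPT}(\boldsymbol D_{\boldsymbol\theta})=\infty$; for $\varepsilon=1$ its right-hand side is $0$.) -/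

import Mathlib

open MeasureTheory
open scoped NNReal ENNReal

noncomputable section

namespace Auction

/-- A direct revelation mechanism for selling one item to `n` buyers. On bid profile `b`,
`alloc b i` is the probability that buyer `i` gets the item and `pay b i` is its expected
payment (of any sign). -/
structure Mechanism (n : ℕ) where
  alloc : (Fin n → ℝ≥0) → Fin n → ℝ
  pay : (Fin n → ℝ≥0) → Fin n → ℝ
  measurable_alloc : Measurable alloc
  measurable_pay : Measurable pay
  alloc_nonneg : ∀ b i, 0 ≤ alloc b i
  sum_alloc_le_one : ∀ b, ∑ i, alloc b i ≤ 1

/-- The quasi-linear utility of buyer `i` with value `v` when the bid profile is `b`. -/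
def Mechanism.utility {n : ℕ} (M : Mechanism n) (i : Fin n) (v : ℝ≥0) (b : Fin n → ℝ≥0) : ℝ :=
  (v : ℝ) * M.alloc b i - M.pay b i

/-- Dominant strategy incentive compatibility: whatever the bids of the others, bidding the
true value `b i` is at least as good for buyer `i` as any other bid `r`. -/
def Mechanism.DSIC {n : ℕ} (M : Mechanism n) : Prop :=
  ∀ (i : Fin n) (b : Fin n → ℝ≥0) (r : ℝ≥0),
    M.utility i (b i) (Function.update b i r) ≤ M.utility i (b i) b

/-- Individual rationality: a truthful buyer has nonnegative utility, whatever the bids of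
the others. -/
def Mechanism.IR {n : ℕ} (M : Mechanism n) : Prop :=
  ∀ (i : Fin n) (b : Fin n → ℝ≥0), 0 ≤ M.utility i (b i) b

/-- The expected revenue when values are drawn from the product distribution of the `D i`:
expectation of the positive part of the total payment minus that of its negative part, in the
extended reals. If both are infinite the expectation is undefined and this is
`⊤ - ⊤ = ⊥`, so that such a mechanism does not count in the supremum below. -/
def revenue {n : ℕ} (M : Mechanism n) (D : Fin n → Measure ℝ≥0) : EReal :=
  ((∫⁻ v, ENNReal.ofReal (∑ i, M.pay v i) ∂Measure.pi D : ℝ≥0∞) : EReal) -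
    ((∫⁻ v, ENNReal.ofReal (-∑ i, M.pay v i) ∂Measure.pi D : ℝ≥0∞) : EReal)

/-- The optimal revenue: supremum of the expected revenue over all DSIC and IR mechanisms
(possibly `⊤`). -/
def OPT {n : ℕ} (D : Fin n → Measure ℝ≥0) : EReal :=
  ⨆ (M : Mechanism n) (_ : M.DSIC) (_ : M.IR), revenue M D

/-- The quantile of a value: `q^D(v) = Pr_{x ∼ D}[x ≥ v]`. -/
def quantile (D : Measure ℝ≥0) (v : ℝ≥0) : ℝ := D.real (Set.Ici v)

/-- The value at quantile `q ∈ (0, 1]`: the largest value whose quantile is at least `q`. -/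
def valueAt (D : Measure ℝ≥0) (q : ℝ) : ℝ≥0 := sSup {v | q ≤ quantile D v}

/-- The truncated distribution `D_θ`: draw a uniform quantile `q ∈ (0, 1]`, output the value at
quantile `q` if `q ≤ θ`, and round it down to `0` otherwise. Its quantile function is computed
in `quantile_truncate`. -/
def truncate (D : Measure ℝ≥0) (θ : ℝ) : Measure ℝ≥0 :=
  (volume.restrict (Set.Ioc (0 : ℝ) 1)).map fun q => if q ≤ θ then valueAt D q else 0

theorem quantile_antitone (D : Measure ℝ≥0) [IsProbabilityMeasure D] :
    Antitone (quantile D) := fun _ _ h => measureReal_mono (Set.Ici_subset_Ici.2 h)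

theorem quantile_zero (D : Measure ℝ≥0) [IsProbabilityMeasure D] : quantile D 0 = 1 := by
  have : Set.Ici (0 : ℝ≥0) = Set.univ := by ext; simp
  simp [quantile, this]

theorem bddAbove_quantile (D : Measure ℝ≥0) [IsProbabilityMeasure D] {q : ℝ} (hq : 0 < q) :
    BddAbove {v | q ≤ quantile D v} := by
  have ht : Filter.Tendsto (fun k : ℕ => D (Set.Ici (k : ℝ≥0))) Filter.atTop
      (nhds (D (⋂ k : ℕ, Set.Ici (k : ℝ≥0)))) :=
    tendsto_measure_iInter_atTop (fun _ => measurableSet_Ici.nullMeasurableSet)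
      (fun a b h => Set.Ici_subset_Ici.2 (by exact_mod_cast h)) ⟨0, measure_ne_top _ _⟩
  have he : (⋂ k : ℕ, Set.Ici (k : ℝ≥0)) = ∅ := by
    ext x
    obtain ⟨k, hk⟩ := exists_nat_gt x
    simp only [Set.mem_iInter, Set.mem_Ici, Set.mem_empty_iff_false, iff_false, not_forall, not_le]
    exact ⟨k, hk⟩
  rw [he, measure_empty] at ht
  have ht' : Filter.Tendsto (fun k : ℕ => quantile D k) Filter.atTop (nhds 0) := by
    have h := (ENNReal.tendsto_toReal ENNReal.zero_ne_top).comp ht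
    rwa [ENNReal.toReal_zero] at h
  obtain ⟨k, hk⟩ := (ht'.eventually_lt_const hq).exists
  refine ⟨k, fun v hv => ?_⟩
  by_contra! h
  exact absurd (hv.trans (quantile_antitone D h.le)) (not_le.2 hk)

theorem le_quantile_valueAt (D : Measure ℝ≥0) [IsProbabilityMeasure D] {q : ℝ} (hq : 0 < q)
    (hq1 : q ≤ 1) : q ≤ quantile D (valueAt D q) := by
  set S : Set ℝ≥0 := {v | q ≤ quantile D v} with hS
  have hne : S.Nonempty := ⟨0, by simpa [hS, quantile_zero] using hq1⟩
  obtain ⟨u, hu, hlim, huS⟩ := exists_seq_tendsto_sSup hne (bddAbove_quantile D hq)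
  have ht := tendsto_measure_iInter_atTop (μ := D) (s := fun k => Set.Ici (u k))
    (fun _ => measurableSet_Ici.nullMeasurableSet)
      (fun a b h => Set.Ici_subset_Ici.2 (hu h)) ⟨0, measure_ne_top _ _⟩
  have he : (⋂ k : ℕ, Set.Ici (u k)) = Set.Ici (sSup S) := by
    ext x
    simp only [Set.mem_iInter, Set.mem_Ici]
    exact ⟨fun h => le_of_tendsto' hlim h,
      fun h k => (le_csSup (bddAbove_quantile D hq) (huS k)).trans h⟩
  rw [he] at ht
  have ht' := (ENNReal.tendsto_toReal (measure_ne_top D (Set.Ici (sSup S)))).comp ht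
  exact ge_of_tendsto' ht' huS

theorem le_valueAt_iff (D : Measure ℝ≥0) [IsProbabilityMeasure D] {q : ℝ} (hq : 0 < q)
    (hq1 : q ≤ 1) (v : ℝ≥0) : v ≤ valueAt D q ↔ q ≤ quantile D v :=
  ⟨fun h => (le_quantile_valueAt D hq hq1).trans (quantile_antitone D h),
    fun h => le_csSup (bddAbove_quantile D hq) h⟩

theorem aemeasurable_truncate (D : Measure ℝ≥0) [IsProbabilityMeasure D] (θ : ℝ) :
    AEMeasurable (fun q => if q ≤ θ then valueAt D q else 0)
      (volume.restrict (Set.Ioc (0 : ℝ) 1)) := by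
  apply aemeasurable_restrict_of_antitoneOn measurableSet_Ioc
  intro a ha b hb hab
  have h : valueAt D b ≤ valueAt D a := (le_valueAt_iff D ha.1 ha.2 _).2
    (hab.trans (le_quantile_valueAt D hb.1 hb.2))
  by_cases hbθ : b ≤ θ
  · simpa [hbθ, hab.trans hbθ] using h
  · simp [hbθ]

instance isProbabilityMeasure_truncate (D : Measure ℝ≥0) [IsProbabilityMeasure D] (θ : ℝ) :
    IsProbabilityMeasure (truncate D θ) := by
  have : IsProbabilityMeasure (volume.restrict (Set.Ioc (0 : ℝ) 1)) := ⟨by simp⟩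
  exact Measure.isProbabilityMeasure_map (aemeasurable_truncate D θ)

/-- The truncated distribution has quantile function `min {q^D(v), θ}` at `v > 0` and `1` at
`v = 0`. -/
theorem quantile_truncate (D : Measure ℝ≥0) [IsProbabilityMeasure D] {θ : ℝ} (hθ : 0 ≤ θ)
    (v : ℝ≥0) : quantile (truncate D θ) v = if 0 < v then min (quantile D v) θ else 1 := by
  split_ifs with hv
  · have hq1 : quantile D v ≤ 1 := by
      rw [← quantile_zero D]; exact quantile_antitone D hv.le
    have hq0 : 0 ≤ quantile D v := measureReal_nonneg
    have hset : (fun q => if q ≤ θ then valueAt D q else 0) ⁻¹' Set.Ici v ∩ Set.Ioc (0 : ℝ) 1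
        = Set.Ioc 0 (min (quantile D v) θ) := by
      ext q
      simp only [Set.mem_inter_iff, Set.mem_preimage, Set.mem_Ici, Set.mem_Ioc, le_min_iff]
      constructor
      · rintro ⟨h, h0, h1⟩
        split_ifs at h with hq
        · exact ⟨h0, (le_valueAt_iff D h0 h1 v).1 h, hq⟩
        · exact absurd h (not_le.2 hv)
      · rintro ⟨h0, h1, h2⟩
        refine ⟨?_, h0, h1.trans hq1⟩
        rw [if_pos h2]
        exact (le_valueAt_iff D h0 (h1.trans hq1) v).2 h1
    rw [quantile, truncate, Measure.real,
      Measure.map_apply_of_aemeasurable (aemeasurable_truncate D θ) measurableSet_Ici,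
      Measure.restrict_apply' measurableSet_Ioc, hset, Real.volume_Ioc, sub_zero,
      ENNReal.toReal_ofReal (le_min hq0 hθ)]
  · rw [show v = 0 from le_antisymm (not_lt.1 hv) bot_le, quantile_zero]

end Auction

end

/-!
The proof passes through ironed virtual values on finite grids of prices, and through compactness
of the set of admissible threshold vectors.

Fix a grid `0, δ, …, mδ` and cut the half-line into the corresponding cells. For a single buyer,
the upper concave hull of the points (quantile of `kδ`, revenue of the posted price `kδ`) has
slopes `φ j` on the cells (`exists_ironing`, `IsIroned`). Two properties of `φ` matter: its tail
expectations dominate the revenue of every grid price, and they equal it at every index where `φ`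
jumps up, as such an index is a vertex of the hull.

* Domination gives the upper bound. In a DSIC and IR mechanism the allocation of a buyer is monotone
  in its own value, so its expected payment is at most its expected ironed virtual value, up to
  twice the mesh (`integral_pay_le`). Summing over the buyers, and refining the grid with Fatou's
  lemma, bounds `OPT D` by the limit of `E[max_i φ_i]` along any sequence of grids
  (`OPT_le_of_grids`). No finiteness of the optimal revenue is needed.
* Equality at the jumps gives the lower bound. The auction that sells to the buyer with the highest
  positive virtual value charges a grid price at which `φ_i` jumps up, hence earns exactly
  `E[max_i φ_i]` (`integral_maxVirtual_le_OPT`).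

Order the pairs (virtual value, buyer) lexicographically; this is also how ties are broken. Let
`r` be the largest pair that is reached with probability at least `1 - ε`. Ignoring the virtual
values of rank below `r` keeps a `1 - ε` fraction of `E[max_i φ_i]`, as the event of reaching `r`
is positively correlated with the maximum (`integral_cutoff_ge`). The remaining auction
only uses quantiles `q_i` up to the probability that buyer `i` reaches `r`, so it earns the same
from the truncated distributions (`integral_cutoff_le_OPT_truncate`). By maximality of `r` the
product of the `1 - q_i` over all buyers but that of `r` is at least `ε` (`exists_rank`), which
yields `∑ q_i < ln (1 / ε) + 1`, the summand `1` accounting for the buyer left out.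

The thresholds so obtained depend on the grid. They lie in a compact set on which the last
inequality is still strict, so a limit point, raised slightly in every coordinate, satisfies the
required bound and dominates the thresholds of infinitely many grids. The additive guarantee follows
from the multiplicative one since `OPT D ≤ 1` for values in `[0, 1]`.
-/

namespace Auction

/-! ### Concave hulls and summation by parts -/

/-- Abel summation: nonpositive tails stay nonpositive under nonnegative nondecreasing weights. -/
theorem sum_Ico_mul_nonpos_of_tails_nonpos {z d : ℕ → ℝ} {m : ℕ}
    (hz : ∀ j, j + 1 < m → z j ≤ z (j + 1)) (hz0 : ∀ j < m, 0 ≤ z j)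
    (hd : ∀ k < m, ∑ j ∈ Finset.Ico k m, d j ≤ 0) : ∑ j ∈ Finset.Ico 0 m, z j * d j ≤ 0 := by
  -- Downward induction: a weighted tail is at most its first weight times the plain tail.
  have key : ∀ l k, k + l + 1 = m →
      ∑ j ∈ Finset.Ico k m, z j * d j ≤ z k * ∑ j ∈ Finset.Ico k m, d j := by
    intro l
    induction l with
    | zero =>
      intro k hk
      subst hk
      simp
    | succ l ih =>
      intro k hk
      have hkm : k < m := by omega
      rw [Finset.sum_eq_sum_Ico_succ_bot hkm, Finset.sum_eq_sum_Ico_succ_bot hkm, mul_add]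
      have h1 := ih (k + 1) (by omega)
      have h2 := mul_le_mul_of_nonpos_right (hz k (by omega)) (hd (k + 1) (by omega))
      linarith
  rcases Nat.eq_zero_or_pos m with rfl | hm
  · simp
  · exact (key (m - 1) 0 (by omega)).trans
      (mul_nonpos_of_nonneg_of_nonpos (hz0 0 hm) (hd 0 hm))

/-- Slopes of the upper concave hull of the points `(q k, R k)`, `k ≤ m`, with `φ k` the slope
between the abscissas `q (k + 1)` and `q k`, truncated at zero. The hull is built edge by edge from
the point of index `m`; the bound by any `s` dominating the chords to that point is what keeps the
slopes monotone in the induction. -/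
theorem exists_ironing (q R : ℕ → ℝ) (hq : Antitone q)
    (hR : ∀ k l, k ≤ l → q k = q l → R k ≤ R l) (m : ℕ) :
    ∃ φ : ℕ → ℝ, Monotone φ ∧ (∀ j, 0 ≤ φ j) ∧
      (∀ s : ℝ, 0 ≤ s → (∀ k < m, R k - R m ≤ s * (q k - q m)) → ∀ j, φ j ≤ s) ∧
      (∀ k ≤ m, R k - R m ≤ ∑ j ∈ Finset.Ico k m, φ j * (q j - q (j + 1))) ∧
      (∀ k < m, 0 < φ k → (∀ j < k, φ j < φ k) →
        R k - R m = ∑ j ∈ Finset.Ico k m, φ j * (q j - q (j + 1))) := by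
  induction m using Nat.strong_induction_on with
  | _ m ih =>
  by_cases hpos : ∃ k < m, R m < R k
  swap
  · push Not at hpos
    refine ⟨fun _ => 0, monotone_const, fun _ => le_rfl, fun s hs _ _ => hs, fun k hk => ?_,
      fun k _ h => absurd h (lt_irrefl _)⟩
    rcases hk.eq_or_lt with rfl | hk
    · simp
    · simpa using hpos k hk
  obtain ⟨k₀, hk₀, hRk₀⟩ := hpos
  have hqlt : ∀ k < m, R m < R k → q m < q k := fun k hk h =>
    (hq hk.le).lt_of_ne fun he => absurd (hR k m hk.le he.symm) (not_le.2 h)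
  -- The steepest chord to the point of index `m` is the first edge of the hull.
  obtain ⟨a, ha, hmax⟩ := Finset.exists_max_image ((Finset.range m).filter fun k => R m < R k)
    (fun k => (R k - R m) / (q k - q m)) ⟨k₀, by simp [hk₀, hRk₀]⟩
  simp only [Finset.mem_filter, Finset.mem_range] at ha hmax
  obtain ⟨ham, hRa⟩ := ha
  have hqa := hqlt a ham hRa
  set t := (R a - R m) / (q a - q m) with ht
  have ht0 : 0 < t := div_pos (by linarith) (by linarith)
  have hta : R a - R m = t * (q a - q m) := by
    rw [ht, div_mul_cancel₀]; linarith
  have hbound : ∀ k ≤ m, R k - R m ≤ t * (q k - q m) := by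
    intro k hk
    rcases hk.eq_or_lt with rfl | hk
    · simp
    by_cases h : R m < R k
    · exact (div_le_iff₀ (by linarith [hqlt k hk h])).1 (hmax k ⟨hk, h⟩)
    · have := mul_nonneg ht0.le (sub_nonneg.2 (hq hk.le))
      linarith
  obtain ⟨φ, hmono, h0, hs, hmaj, htight⟩ := ih a ham
  have hφt : ∀ j, φ j ≤ t := hs t ht0.le fun k hk => by
    have := hbound k (by omega)
    linarith
  have htop : ∀ k, a ≤ k → k ≤ m →
      ∑ j ∈ Finset.Ico k m, (if j < a then φ j else t) * (q j - q (j + 1)) =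
        t * (q k - q m) := by
    intro k hak hkm
    rw [Finset.sum_congr rfl (g := fun j => t * (q j - q (j + 1))) fun j hj => by
      rw [if_neg]; have := (Finset.mem_Ico.1 hj).1; omega]
    rw [← Finset.mul_sum]
    congr 1
    have := Finset.sum_Ico_sub (fun j => -q j) hkm
    simp only [sub_neg_eq_add] at this
    rw [Finset.sum_congr rfl (g := fun j => -q (j + 1) + q j) fun j _ => by ring, this]
    ring
  have hsplit : ∀ k < a, ∑ j ∈ Finset.Ico k m, (if j < a then φ j else t) * (q j - q (j + 1)) =
      ∑ j ∈ Finset.Ico k a, φ j * (q j - q (j + 1)) + (R a - R m) := by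
    intro k hk
    rw [← Finset.sum_Ico_consecutive _ hk.le ham.le, htop a le_rfl ham.le, hta]
    congr 1
    exact Finset.sum_congr rfl fun j hj => by rw [if_pos (Finset.mem_Ico.1 hj).2]
  refine ⟨fun j => if j < a then φ j else t, ?_, ?_, ?_, ?_, ?_⟩
  · intro i j hij
    dsimp only
    split_ifs with h1 h2
    · exact hmono hij
    · exact hφt i
    · omega
    · exact le_rfl
  · intro j
    dsimp only
    split_ifs
    exacts [h0 j, ht0.le]
  · intro s _ hsl j
    have hts : t ≤ s := (div_le_iff₀ (by linarith)).2 (hsl a ham)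
    dsimp only
    split_ifs
    exacts [(hφt j).trans hts, hts]
  · intro k hk
    dsimp only
    by_cases hka : k < a
    · rw [hsplit k hka]
      linarith [hmaj k hka.le]
    · rw [htop k (by omega) hk]
      exact hbound k hk
  · intro k hk hpk hlt
    dsimp only at hpk hlt ⊢
    rcases lt_trichotomy k a with hka | rfl | hka
    · rw [hsplit k hka, ← htight k hka (by simpa [hka] using hpk)
        fun j hj => by simpa [hka, hj.trans hka] using hlt j hj]
      ring
    · rw [htop k le_rfl hk.le, hta]
    · have := hlt a hka
      simp [not_lt.2 hka.le] at this

/-! ### Cells of a grid and the payments of a single buyer -/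

/-- The index of the grid cell containing the value `v`: the cells are `[jδ, (j + 1)δ)` for
`j < m`, and cell `m` is `[mδ, ∞)`. -/
noncomputable def cell (δ : ℝ≥0) (m : ℕ) (v : ℝ≥0) : ℕ := min ⌊v / δ⌋₊ m

/-- The probability that a value lies in cell `j` or higher. -/
noncomputable def cellTail (D : Measure ℝ≥0) (δ : ℝ≥0) (m j : ℕ) : ℝ := D.real {v | j ≤ cell δ m v}

section Cell

variable {δ : ℝ≥0} {m : ℕ}

theorem le_cell_iff (hδ : 0 < δ) {k : ℕ} {v : ℝ≥0} : k ≤ cell δ m v ↔ k ≤ m ∧ k * δ ≤ v := by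
  rw [cell, le_min_iff, Nat.le_floor_iff zero_le, le_div_iff₀ hδ, and_comm]

theorem cell_le (v : ℝ≥0) : cell δ m v ≤ m := min_le_right _ _

theorem cell_mul_le (hδ : 0 < δ) (v : ℝ≥0) : cell δ m v * δ ≤ v := ((le_cell_iff hδ).1 le_rfl).2

theorem cell_mono : Monotone (cell δ m) := fun a b h => by
  unfold cell
  gcongr

theorem measurable_cell : Measurable (cell δ m) := cell_mono.measurable

theorem lt_succ_cell_mul (hδ : 0 < δ) {v : ℝ≥0} (h : cell δ m v < m) :
    v < (cell δ m v + 1 : ℕ) * δ := by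
  by_contra! hv
  have := (le_cell_iff hδ).2 ⟨h, hv⟩
  omega

variable (D : Measure ℝ≥0)

theorem cellTail_antitone [IsProbabilityMeasure D] : Antitone (cellTail D δ m) := fun _ _ h =>
  measureReal_mono fun _ hv => le_trans h hv

theorem cellTail_nonneg (j : ℕ) : 0 ≤ cellTail D δ m j := measureReal_nonneg

theorem cellTail_eq_quantile (hδ : 0 < δ) {j : ℕ} (hj : j ≤ m) :
    cellTail D δ m j = quantile D (j * δ) := by
  unfold cellTail quantile
  congr 1
  ext v
  simp [le_cell_iff hδ, hj]

theorem cellTail_of_lt {j : ℕ} (hj : m < j) : cellTail D δ m j = 0 := by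
  have : {v | j ≤ cell δ m v} = ∅ := by
    ext v
    simpa using (cell_le v).trans_lt hj
  rw [cellTail, this, measureReal_empty]

theorem integrable_cell [IsProbabilityMeasure D] (c : ℕ → ℝ) :
    Integrable (fun v => c (cell δ m v)) D := by
  refine Integrable.of_bound
    ((measurable_from_top.comp measurable_cell).aestronglyMeasurable)
    (∑ j ∈ Finset.range (m + 1), |c j|) (Filter.Eventually.of_forall fun v => ?_)
  exact Finset.single_le_sum (f := fun j => |c j|) (fun j _ => abs_nonneg _)
    (Finset.mem_range.2 (Nat.lt_succ_of_le (cell_le v)))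

theorem integral_cellTail [IsProbabilityMeasure D] (a : ℝ) (j : ℕ) :
    ∫ v, (if j ≤ cell δ m v then a else 0) ∂D = a * cellTail D δ m j := by
  have hms : MeasurableSet {v | j ≤ cell δ m v} := measurable_cell (measurableSet_Ici (a := j))
  rw [cellTail, mul_comm, ← smul_eq_mul, ← integral_indicator_const a hms]
  exact integral_congr_ae (Filter.Eventually.of_forall fun v => by simp [Set.indicator_apply])

theorem integral_cell [IsProbabilityMeasure D] (c : ℕ → ℝ) (k : ℕ) :
    ∫ v, (if k ≤ cell δ m v then c (cell δ m v) else 0) ∂D =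
      ∑ j ∈ Finset.Ico k (m + 1), c j * (cellTail D δ m j - cellTail D δ m (j + 1)) := by
  have hint : ∀ j, Integrable (fun v => if j ≤ cell δ m v then (1 : ℝ) else 0) D := fun j =>
    integrable_cell D fun l => if j ≤ l then (1 : ℝ) else 0
  have hpt : ∀ v, (if k ≤ cell δ m v then c (cell δ m v) else 0) =
      ∑ j ∈ Finset.Ico k (m + 1), c j * ((if j ≤ cell δ m v then (1 : ℝ) else 0) -
        (if j + 1 ≤ cell δ m v then (1 : ℝ) else 0)) := by
    intro v
    have hterm : ∀ j, c j * ((if j ≤ cell δ m v then (1 : ℝ) else 0) -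
        (if j + 1 ≤ cell δ m v then (1 : ℝ) else 0)) =
          if j = cell δ m v then c j else 0 := by
      intro j
      rcases lt_trichotomy j (cell δ m v) with h | h | h
      · simp [h.le, Nat.succ_le_of_lt h, h.ne]
      · simp [h]
      · simp [not_le.2 h, h.ne', not_le.2 (h.trans (Nat.lt_succ_self j))]
    simp only [hterm, Finset.sum_ite_eq', Finset.mem_Ico, Nat.lt_succ_of_le (cell_le v), and_true]
  have hdiff : ∀ j, Integrable (fun v => c j * ((if j ≤ cell δ m v then (1 : ℝ) else 0) -
      (if j + 1 ≤ cell δ m v then (1 : ℝ) else 0))) D := fun j =>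
    integrable_cell D fun l => c j * ((if j ≤ l then (1 : ℝ) else 0) - if j + 1 ≤ l then 1 else 0)
  simp only [hpt]
  rw [integral_finsetSum _ fun j _ => hdiff j]
  refine Finset.sum_congr rfl fun j _ => ?_
  rw [integral_const_mul, integral_sub (hint j) (hint (j + 1)), integral_cellTail,
    integral_cellTail]
  simp

end Cell

/-- A truthful payment is at most `v x(v) - ∫₀ᵛ x`. Here the integral is replaced by a sum over the
grid points above the cells rather than below them, and `v` by the grid point below it; each of the
two changes costs at most `δ`. -/
theorem pay_le_of_grid {x p : ℝ≥0 → ℝ} (hx : Monotone x) (hx0 : ∀ v, 0 ≤ x v)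
    (hx1 : ∀ v, x v ≤ 1) (hp : ∀ u v : ℝ≥0, p v - p u ≤ v * (x v - x u)) (hp0 : p 0 ≤ 0)
    {δ : ℝ≥0} (hδ : 0 < δ) {m : ℕ} (v : ℝ≥0) :
    p (min v (m * δ)) ≤ 2 * δ + (cell δ m v * δ) * x v -
      δ * ∑ j ∈ Finset.range (cell δ m v), x ((j + 1 : ℕ) * δ) := by
  set k := cell δ m v with hk
  set u := min v (m * δ) with hu
  have hδ0 : (0 : ℝ) < δ := by exact_mod_cast hδ
  have hgrid : ∀ k : ℕ, p (k * δ) ≤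
      (k * δ : ℝ) * x (k * δ) - δ * ∑ j ∈ Finset.range k, x (j * δ) := by
    intro k
    induction k with
    | zero => simpa using hp0
    | succ k ih =>
      have h := hp (k * δ) ((k + 1 : ℕ) * δ)
      rw [Finset.sum_range_succ]
      push_cast at h ⊢
      nlinarith
  -- The capped value `u` is within `δ` of the grid point of its cell, also in the unbounded cell.
  have hku : (k : ℝ≥0) * δ ≤ u := le_min (cell_mul_le hδ v) (by gcongr; exact cell_le v)
  have huk : (u : ℝ) ≤ k * δ + δ := by
    have : u ≤ (k + 1 : ℕ) * δ := by
      rcases (cell_le (δ := δ) (m := m) v).lt_or_eq with h | h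
      · exact (min_le_left _ _).trans (lt_succ_cell_mul hδ h).le
      · refine (min_le_right _ _).trans ?_
        rw [hk, h]
        gcongr
        simp
    have h' : (u : ℝ) ≤ (((k + 1 : ℕ) * δ : ℝ≥0) : ℝ) := by exact_mod_cast this
    push_cast at h'
    linarith
  have h1 := hp (k * δ) u
  have h2 := hgrid k
  have hxu : x u ≤ x v := hx (min_le_left _ _)
  have hxk : x (k * δ) ≤ x u := hx hku
  -- Shifting the sum by one index changes it by `x (kδ) - x 0 ≤ 1`.
  have h3 : ∑ j ∈ Finset.range k, x ((j + 1 : ℕ) * δ) ≤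
      ∑ j ∈ Finset.range k, x (j * δ) + 1 := by
    have ha := Finset.sum_range_succ (fun j : ℕ => x (j * δ)) k
    have hb := Finset.sum_range_succ' (fun j : ℕ => x (j * δ)) k
    have hc := hx1 (k * δ)
    have hd := hx0 ((0 : ℕ) * δ)
    linarith
  have h4 : (u : ℝ) * (x u - x (k * δ)) ≤ (k * δ + δ) * (x u - x (k * δ)) :=
    mul_le_mul_of_nonneg_right huk (sub_nonneg.2 hxk)
  have h5 : (δ : ℝ) * (x u - x (k * δ)) ≤ δ * 1 :=
    mul_le_mul_of_nonneg_left (by linarith [hx1 u, hx0 (k * δ)]) hδ0.le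
  have h6 : (k * δ : ℝ) * x u ≤ k * δ * x v := mul_le_mul_of_nonneg_left hxu (by positivity)
  have h7 : (δ : ℝ) * ∑ j ∈ Finset.range k, x ((j + 1 : ℕ) * δ) ≤
      δ * (∑ j ∈ Finset.range k, x (j * δ) + 1) := mul_le_mul_of_nonneg_left h3 hδ0.le
  linarith

theorem sum_range_tail_swap (q z : ℕ → ℝ) (n : ℕ) :
    ∑ k ∈ Finset.range n, (∑ j ∈ Finset.range k, z j) * (q k - q (k + 1)) =
      ∑ j ∈ Finset.range n, z j * q (j + 1) - (∑ j ∈ Finset.range n, z j) * q n := by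
  induction n with
  | zero => simp
  | succ n ih =>
    rw [Finset.sum_range_succ, ih, Finset.sum_range_succ, Finset.sum_range_succ]
    ring

/-- The expected payment of a single buyer, with values capped at the top of the grid, is at most
the expected ironed virtual value of the allocation, up to twice the mesh. The function `φ` may
be anything whose tail expectations dominate the revenues of the posted grid prices. -/
theorem integral_pay_le (D : Measure ℝ≥0) [IsProbabilityMeasure D] {x p : ℝ≥0 → ℝ}
    (hx : Monotone x) (hx0 : ∀ v, 0 ≤ x v) (hx1 : ∀ v, x v ≤ 1)
    (hp : ∀ u v : ℝ≥0, p v - p u ≤ v * (x v - x u)) (hp0 : p 0 ≤ 0)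
    {δ : ℝ≥0} (hδ : 0 < δ) {m : ℕ} (hpi : Integrable (fun v => p (min v (m * δ))) D)
    {φ : ℕ → ℝ} (hφ : ∀ k ≤ m, k * δ * cellTail D δ m k ≤
      ∑ j ∈ Finset.Ico k (m + 1), φ j * (cellTail D δ m j - cellTail D δ m (j + 1))) :
    ∫ v, p (min v (m * δ)) ∂D ≤ 2 * δ + ∫ v, φ (cell δ m v) * x v ∂D := by
  set q := cellTail D δ m with hq
  have hδ0 : (0 : ℝ) < δ := by exact_mod_cast hδ
  -- `z k` bounds `x` on cell `k` from above or below, whichever maximizes `(kδ - φ k) x`.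
  set y : ℕ → ℝ := fun k => if k < m then x ((k + 1 : ℕ) * δ) else 1 with hy
  set z : ℕ → ℝ := fun k => if φ k ≤ k * δ then y k else x (k * δ) with hz
  have hxy : ∀ k : ℕ, x (k * δ) ≤ y k := by
    intro k
    simp only [hy]
    split_ifs
    · exact hx (by gcongr; simp)
    · exact hx1 _
  have hxz : ∀ k : ℕ, x (k * δ) ≤ z k := by
    intro k
    simp only [hz]
    split_ifs
    exacts [hxy k, le_rfl]
  have hzy : ∀ k, z k ≤ y k := by
    intro k
    simp only [hz]
    split_ifs
    exacts [le_rfl, hxy k]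
  have hz0 : ∀ k, 0 ≤ z k := fun k => (hx0 _).trans (hxz k)
  have hzm : ∀ k, k < m → z k ≤ x ((k + 1 : ℕ) * δ) := fun k hk => by
    simpa [hy, hk] using hzy k
  set C : ℕ → ℝ := fun k => (k * δ - φ k) * z k - δ * ∑ j ∈ Finset.range k, z j with hC
  have hpt : ∀ v, p (min v (m * δ)) ≤ 2 * δ + φ (cell δ m v) * x v + C (cell δ m v) := by
    intro v
    have h1 := pay_le_of_grid hx hx0 hx1 hp hp0 hδ (m := m) v
    set k := cell δ m v with hk
    have hkm : k ≤ m := cell_le v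
    have hxv : x (k * δ) ≤ x v := hx (cell_mul_le hδ v)
    have hvy : x v ≤ y k := by
      simp only [hy]
      split_ifs with h
      · exact hx (lt_succ_cell_mul hδ h).le
      · exact hx1 _
    have h2 : (k * δ - φ k) * x v ≤ (k * δ - φ k) * z k := by
      simp only [hz]
      split_ifs with h
      · exact mul_le_mul_of_nonneg_left hvy (sub_nonneg.2 h)
      · exact mul_le_mul_of_nonpos_left hxv (by linarith)
    have h3 : (δ : ℝ) * ∑ j ∈ Finset.range k, z j ≤
        δ * ∑ j ∈ Finset.range k, x ((j + 1 : ℕ) * δ) :=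
      mul_le_mul_of_nonneg_left (Finset.sum_le_sum fun j hj =>
        hzm j ((Finset.mem_range.1 hj).trans_le hkm)) hδ0.le
    simp only [hC]
    linarith
  -- After summation by parts, `∫ C` is the `z`-weighted sum of the differences between the marginal
  -- revenues and the expected virtual values of the cells, whose tails are nonpositive by `hφ`.
  have hCi : ∫ v, C (cell δ m v) ∂D ≤ 0 := by
    have h1 := integral_cell (δ := δ) (m := m) D C 0
    simp only [zero_le, if_true] at h1
    rw [h1, ← hq]
    have hqm : q (m + 1) = 0 := cellTail_of_lt D (Nat.lt_succ_self m)
    have h2 : ∑ j ∈ Finset.Ico 0 (m + 1), C j * (q j - q (j + 1)) =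
        ∑ j ∈ Finset.Ico 0 (m + 1), z j *
          ((j * δ * q j - (j + 1 : ℕ) * δ * q (j + 1)) - φ j * (q j - q (j + 1))) := by
      have h3 := sum_range_tail_swap q z (m + 1)
      rw [hqm, mul_zero, sub_zero] at h3
      simp only [hC, sub_mul, Finset.sum_sub_distrib, ← Finset.range_eq_Ico] at h3 ⊢
      have h4 : ∑ k ∈ Finset.range (m + 1), δ * (∑ j ∈ Finset.range k, z j) * (q k - q (k + 1)) =
          δ * ∑ j ∈ Finset.range (m + 1), z j * q (j + 1) := by
        rw [← h3, Finset.mul_sum]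
        exact Finset.sum_congr rfl fun k _ => by ring
      rw [h4, Finset.mul_sum, ← Finset.sum_sub_distrib, ← Finset.sum_sub_distrib]
      refine Finset.sum_congr rfl fun k _ => ?_
      push_cast
      ring
    rw [h2]
    refine sum_Ico_mul_nonpos_of_tails_nonpos (fun j hj => ?_) (fun j _ => hz0 j) fun k hk => ?_
    · exact (hzm j (by omega)).trans (hxz (j + 1))
    · rw [Finset.sum_sub_distrib]
      have h3 := Finset.sum_Ico_sub (fun j : ℕ => -(j * δ * q j)) hk.le
      have h4 : ∑ j ∈ Finset.Ico k (m + 1), (j * δ * q j - (j + 1 : ℕ) * δ * q (j + 1)) =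
          k * δ * q k := by
        rw [Finset.sum_congr rfl (g := fun j : ℕ =>
          -((j + 1 : ℕ) * δ * q (j + 1)) - -(j * δ * q j)) fun j _ => by ring, h3, hqm]
        ring
      rw [h4]
      linarith [hφ k (by omega)]
  have hxi : Integrable (fun v => φ (cell δ m v) * x v) D := by
    refine (integrable_cell D φ).mul_bdd (c := 1) hx.measurable.aestronglyMeasurable
      (Filter.Eventually.of_forall fun v => ?_)
    rw [Real.norm_eq_abs, abs_of_nonneg (hx0 v)]
    exact hx1 v
  have hci : Integrable (fun v => 2 * (δ : ℝ) + φ (cell δ m v) * x v) D :=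
    (integrable_const _).add hxi
  calc ∫ v, p (min v (m * δ)) ∂D
      ≤ ∫ v, (2 * δ + φ (cell δ m v) * x v + C (cell δ m v)) ∂D :=
        integral_mono hpi (hci.add (integrable_cell D C)) hpt
    _ = 2 * δ + ∫ v, φ (cell δ m v) * x v ∂D + ∫ v, C (cell δ m v) ∂D := by
        rw [integral_add hci (integrable_cell D C),
          integral_add (integrable_const _) hxi]
        simp
    _ ≤ _ := by linarith

/-! ### Upper bound on the optimal revenue -/

section UpperBound

variable {n : ℕ} (D : Fin n → Measure ℝ≥0) [∀ i, IsProbabilityMeasure (D i)]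

theorem measurable_update_prod (i : Fin n) :
    Measurable fun z : (Fin n → ℝ≥0) × ℝ≥0 => Function.update z.1 i z.2 := by
  refine measurable_pi_lambda _ fun j => ?_
  rcases eq_or_ne j i with rfl | h
  · simpa using measurable_snd
  · simpa [h, Function.comp_def] using (measurable_pi_apply j).comp measurable_fst

/-- Resampling one coordinate of a product distribution preserves it. -/
theorem measurePreserving_update (i : Fin n) :
    MeasurePreserving (fun z : (Fin n → ℝ≥0) × ℝ≥0 => Function.update z.1 i z.2)
      ((Measure.pi D).prod (D i)) (Measure.pi D) := by
  refine ⟨measurable_update_prod i, (Measure.pi_eq fun s hs => ?_).symm⟩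
  have hpre : (fun z : (Fin n → ℝ≥0) × ℝ≥0 => Function.update z.1 i z.2) ⁻¹' Set.univ.pi s =
      Set.univ.pi (Function.update s i Set.univ) ×ˢ s i := by
    ext z
    simp only [Set.mem_preimage, Set.mem_univ_pi, Set.mem_prod]
    constructor
    · intro h
      refine ⟨fun j => ?_, by simpa using h i⟩
      rcases eq_or_ne j i with rfl | hj
      · simp
      · simpa [hj] using h j
    · rintro ⟨h, hi⟩ j
      rcases eq_or_ne j i with rfl | hj
      · simpa using hi
      · simpa [hj] using h j
  rw [Measure.map_apply (measurable_update_prod i) (MeasurableSet.univ_pi hs), hpre,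
    Measure.prod_prod, Measure.pi_pi, ← Finset.mul_prod_erase _ _ (Finset.mem_univ i),
    ← Finset.mul_prod_erase Finset.univ (fun j => D j (s j)) (Finset.mem_univ i)]
  rw [Function.update_self, measure_univ, one_mul, mul_comm]
  congr 1
  exact Finset.prod_congr rfl fun j hj => by
    rw [Function.update_of_ne (Finset.ne_of_mem_erase hj)]

/-- Integrating first over the value of buyer `i`, with the values of the others held fixed. -/
theorem integral_pi_update (i : Fin n) {F : (Fin n → ℝ≥0) → ℝ}
    (hF : Integrable F (Measure.pi D)) :
    Integrable (fun b => ∫ y, F (Function.update b i y) ∂D i) (Measure.pi D) ∧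
      ∫ v, F v ∂Measure.pi D = ∫ b, ∫ y, F (Function.update b i y) ∂D i ∂Measure.pi D := by
  have hmp := measurePreserving_update D i
  have hF' : Integrable (fun z : (Fin n → ℝ≥0) × ℝ≥0 => F (Function.update z.1 i z.2))
      ((Measure.pi D).prod (D i)) := hmp.integrable_comp_of_integrable hF
  refine ⟨hF'.integral_prod_left, ?_⟩
  rw [← integral_prod _ hF']
  conv_lhs => rw [← hmp.map_eq]
  rw [integral_map hmp.measurable.aemeasurable]
  rw [hmp.map_eq]
  exact hF.aestronglyMeasurable

/-- The largest virtual value, where `φ i j` is the virtual value of buyer `i` in cell `j`;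
it is `0` if there are no buyers. -/
noncomputable def maxVirtual (φ : Fin n → ℕ → ℝ) (c : Fin n → ℕ) : ℝ := ⨆ i, φ i (c i)

theorem le_maxVirtual (φ : Fin n → ℕ → ℝ) (c : Fin n → ℕ) (i : Fin n) :
    φ i (c i) ≤ maxVirtual φ c := le_ciSup (f := fun i => φ i (c i)) (Set.finite_range _).bddAbove i

theorem maxVirtual_nonneg {φ : Fin n → ℕ → ℝ} (hφ : ∀ i j, 0 ≤ φ i j) (c : Fin n → ℕ) :
    0 ≤ maxVirtual φ c := Real.iSup_nonneg fun i => hφ i _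

/-- The profile of the cells of the values `v`. -/
noncomputable def cells (δ : ℝ≥0) (m : ℕ) (v : Fin n → ℝ≥0) : Fin n → ℕ := fun i => cell δ m (v i)

theorem measurable_cells {δ : ℝ≥0} {m : ℕ} : Measurable (cells (n := n) δ m) :=
  measurable_pi_lambda _ fun i => measurable_cell.comp (measurable_pi_apply i)

theorem measurable_comp_cells {α : Type*} [MeasurableSpace α] {δ : ℝ≥0} {m : ℕ}
    (F : (Fin n → ℕ) → α) : Measurable fun v => F (cells δ m v) :=
  (measurable_of_countable F).comp measurable_cells

theorem integrable_comp_cells {δ : ℝ≥0} {m : ℕ} (F : (Fin n → ℕ) → ℝ) :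
    Integrable (fun v => F (cells δ m v)) (Measure.pi D) := by
  have hfin : (Set.range fun c : Fin n → Fin (m + 1) => |F fun i => c i|).Finite :=
    Set.finite_range _
  obtain ⟨C, hC⟩ := hfin.bddAbove
  refine Integrable.of_bound (measurable_comp_cells F).aestronglyMeasurable C
    (Filter.Eventually.of_forall fun v => hC ⟨fun i => ⟨cell δ m (v i), ?_⟩, rfl⟩)
  exact Nat.lt_succ_of_le (cell_le _)

section Mechanism

variable {M : Mechanism n}

theorem Mechanism.alloc_le_one (M : Mechanism n) (b : Fin n → ℝ≥0) (i : Fin n) :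
    M.alloc b i ≤ 1 :=
  (Finset.single_le_sum (fun j _ => M.alloc_nonneg b j) (Finset.mem_univ i)).trans
    (M.sum_alloc_le_one b)

theorem Mechanism.DSIC.pay_sub_le (h : M.DSIC) (b : Fin n → ℝ≥0) (i : Fin n) (u v : ℝ≥0) :
    M.pay (Function.update b i v) i - M.pay (Function.update b i u) i ≤
      v * (M.alloc (Function.update b i v) i - M.alloc (Function.update b i u) i) := by
  have := h i (Function.update b i v) u
  simp only [Mechanism.utility, Function.update_self, Function.update_idem] at this
  linarith

theorem Mechanism.DSIC.monotone_alloc (h : M.DSIC) (b : Fin n → ℝ≥0) (i : Fin n) :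
    Monotone fun y => M.alloc (Function.update b i y) i := by
  intro u v huv
  rcases huv.eq_or_lt with rfl | huv
  · exact le_rfl
  have h1 := h.pay_sub_le b i u v
  have h2 := h.pay_sub_le b i v u
  have h3 : (u : ℝ) < v := by exact_mod_cast huv
  dsimp only
  nlinarith

theorem Mechanism.IR.pay_zero_le (h : M.IR) (b : Fin n → ℝ≥0) (i : Fin n) :
    M.pay (Function.update b i 0) i ≤ 0 := by
  have := h i (Function.update b i 0)
  simp only [Mechanism.utility, Function.update_self] at this
  simpa using this

/-- The payment of buyer `i` in excess of the payment at value zero, with the value of buyer `i`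
capped at `N`. -/
def Mechanism.cappedPay (M : Mechanism n) (N : ℝ≥0) (i : Fin n) (v : Fin n → ℝ≥0) : ℝ :=
  M.pay (Function.update v i (min (v i) N)) i - M.pay (Function.update v i 0) i

theorem Mechanism.measurable_cappedPay (M : Mechanism n) (N : ℝ≥0) (i : Fin n) :
    Measurable (M.cappedPay N i) := by
  have h : ∀ f : (Fin n → ℝ≥0) → ℝ≥0, Measurable f →
      Measurable fun v => M.pay (Function.update v i (f v)) i := fun f hf =>
    (measurable_pi_apply i).comp (M.measurable_pay.comp
      ((measurable_update_prod i).comp (measurable_id.prodMk hf)))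
  exact (h _ ((measurable_pi_apply i).min measurable_const)).sub (h _ measurable_const)

theorem Mechanism.DSIC.cappedPay_nonneg (h : M.DSIC) (N : ℝ≥0) (i : Fin n) (v : Fin n → ℝ≥0) :
    0 ≤ M.cappedPay N i v := by
  have := h.pay_sub_le v i (min (v i) N) 0
  simp only [NNReal.coe_zero, zero_mul] at this
  unfold Mechanism.cappedPay
  linarith

theorem Mechanism.DSIC.cappedPay_le (h : M.DSIC) (N : ℝ≥0) (i : Fin n) (v : Fin n → ℝ≥0) :
    M.cappedPay N i v ≤ N := by
  have h1 := h.pay_sub_le v i 0 (min (v i) N)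
  have h2 : ((min (v i) N : ℝ≥0) : ℝ) ≤ N := by exact_mod_cast min_le_right _ _
  have h3 := M.alloc_le_one (Function.update v i (min (v i) N)) i
  have h4 := M.alloc_nonneg (Function.update v i 0) i
  have h5 : ((min (v i) N : ℝ≥0) : ℝ) * (M.alloc (Function.update v i (min (v i) N)) i -
      M.alloc (Function.update v i 0) i) ≤ (min (v i) N : ℝ≥0) * 1 :=
    mul_le_mul_of_nonneg_left (by linarith) (NNReal.coe_nonneg _)
  unfold Mechanism.cappedPay
  linarith

theorem Mechanism.DSIC.integrable_cappedPay (h : M.DSIC) (N : ℝ≥0) (i : Fin n) :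
    Integrable (M.cappedPay N i) (Measure.pi D) :=
  Integrable.of_bound (M.measurable_cappedPay N i).aestronglyMeasurable N
    (Filter.Eventually.of_forall fun v => by
      rw [Real.norm_eq_abs, abs_of_nonneg (h.cappedPay_nonneg N i v)]
      exact h.cappedPay_le N i v)

theorem Mechanism.DSIC.integral_cappedPay_le (h : M.DSIC) {δ : ℝ≥0} (hδ : 0 < δ) {m : ℕ}
    (i : Fin n) {φ : ℕ → ℝ} (hφ : ∀ k ≤ m, k * δ * cellTail (D i) δ m k ≤
      ∑ j ∈ Finset.Ico k (m + 1), φ j * (cellTail (D i) δ m j - cellTail (D i) δ m (j + 1))) :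
    Integrable (fun v => φ (cell δ m (v i)) * M.alloc v i) (Measure.pi D) ∧
    ∫ v, M.cappedPay (m * δ) i v ∂Measure.pi D ≤
      2 * δ + ∫ v, φ (cell δ m (v i)) * M.alloc v i ∂Measure.pi D := by
  have hint : Integrable (fun v => φ (cell δ m (v i)) * M.alloc v i) (Measure.pi D) := by
    refine (integrable_comp_cells D fun c => φ (c i)).mul_bdd (c := 1)
      ((measurable_pi_apply i).comp M.measurable_alloc).aestronglyMeasurable
      (Filter.Eventually.of_forall fun v => ?_)
    rw [Real.norm_eq_abs, abs_of_nonneg (M.alloc_nonneg v i)]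
    exact M.alloc_le_one v i
  refine ⟨hint, ?_⟩
  obtain ⟨hi1, he1⟩ := integral_pi_update D i (h.integrable_cappedPay D (m * δ) i)
  obtain ⟨hi2, he2⟩ := integral_pi_update D i hint
  rw [he1, he2]
  calc _ ≤ ∫ b, (2 * δ + ∫ y, φ (cell δ m (Function.update b i y i)) *
        M.alloc (Function.update b i y) i ∂D i) ∂Measure.pi D := by
        refine integral_mono hi1 ((integrable_const _).add hi2) fun b => ?_
        have hs := integral_pay_le (D i) (x := fun y => M.alloc (Function.update b i y) i)
          (p := fun y => M.pay (Function.update b i y) i - M.pay (Function.update b i 0) i)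
          (h.monotone_alloc b i) (fun v => M.alloc_nonneg _ _) (fun v => M.alloc_le_one _ _)
          (fun u v => by linarith [h.pay_sub_le b i u v]) (by simp) hδ (m := m) ?_ hφ
        · simpa [Mechanism.cappedPay] using hs
        · refine Integrable.of_bound (C := (m * δ : ℝ≥0)) ?_
            (Filter.Eventually.of_forall fun y => ?_)
          · have := (M.measurable_cappedPay (m * δ) i).comp
              ((measurable_update_prod i).comp (measurable_const.prodMk measurable_id :
                Measurable fun y : ℝ≥0 => (b, y)))
            have h2 := this.aestronglyMeasurable (μ := D i)
            refine h2.congr (Filter.Eventually.of_forall fun y => ?_)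
            simp [Mechanism.cappedPay]
          · have h1 := h.cappedPay_nonneg (m * δ) i (Function.update b i y)
            have h2 := h.cappedPay_le (m * δ) i (Function.update b i y)
            simp only [Mechanism.cappedPay, Function.update_idem, Function.update_self] at h1 h2
            rw [Real.norm_eq_abs, abs_of_nonneg h1]
            exact h2
    _ = _ := by
        rw [integral_add (integrable_const _) hi2]
        simp

theorem Mechanism.DSIC.integral_sum_cappedPay_le (h : M.DSIC) {δ : ℝ≥0} (hδ : 0 < δ) {m : ℕ}
    {φ : Fin n → ℕ → ℝ} (hφ0 : ∀ i j, 0 ≤ φ i j)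
    (hφ : ∀ i, ∀ k ≤ m, k * δ * cellTail (D i) δ m k ≤
      ∑ j ∈ Finset.Ico k (m + 1), φ i j * (cellTail (D i) δ m j - cellTail (D i) δ m (j + 1))) :
    ∫ v, ∑ i, M.cappedPay (m * δ) i v ∂Measure.pi D ≤
      2 * n * δ + ∫ v, maxVirtual φ (cells δ m v) ∂Measure.pi D := by
  rw [integral_finsetSum _ fun i _ => h.integrable_cappedPay D (m * δ) i]
  calc _ ≤ ∑ i, (2 * (δ : ℝ) + ∫ v, φ i (cell δ m (v i)) * M.alloc v i ∂Measure.pi D) :=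
        Finset.sum_le_sum fun i _ => (h.integral_cappedPay_le D hδ i (hφ i)).2
    _ = 2 * n * δ + ∫ v, ∑ i, φ i (cell δ m (v i)) * M.alloc v i ∂Measure.pi D := by
        rw [Finset.sum_add_distrib,
          integral_finsetSum _ fun i _ => (h.integral_cappedPay_le D hδ i (hφ i)).1]
        simp
        ring
    _ ≤ _ := by
        gcongr
        · exact integrable_finsetSum _ fun i _ => (h.integral_cappedPay_le D hδ i (hφ i)).1
        · exact integrable_comp_cells D _
        intro v
        calc ∑ i, φ i (cell δ m (v i)) * M.alloc v i
            ≤ ∑ i, maxVirtual φ (cells δ m v) * M.alloc v i :=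
              Finset.sum_le_sum fun i _ => mul_le_mul_of_nonneg_right
                (le_maxVirtual φ (cells δ m v) i) (M.alloc_nonneg v i)
          _ ≤ maxVirtual φ (cells δ m v) := by
              rw [← Finset.mul_sum]
              exact mul_le_of_le_one_right (maxVirtual_nonneg hφ0 _) (M.sum_alloc_le_one v)

end Mechanism

/-- The optimal revenue is bounded by the limit of the expected maximal ironed virtual values
along any sequence of grids whose mesh tends to zero and whose range exhausts the half-line. -/
theorem OPT_le_of_grids {δ : ℕ → ℝ≥0} {m : ℕ → ℕ} (hδ : ∀ K, 0 < δ K)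
    (hδ0 : Filter.Tendsto δ Filter.atTop (nhds 0))
    (hm : Filter.Tendsto (fun K => m K * δ K) Filter.atTop Filter.atTop)
    {φ : ℕ → Fin n → ℕ → ℝ} (hφ0 : ∀ K i j, 0 ≤ φ K i j)
    (hφ : ∀ K i, ∀ k ≤ m K, k * δ K * cellTail (D i) (δ K) (m K) k ≤
      ∑ j ∈ Finset.Ico k (m K + 1),
        φ K i j * (cellTail (D i) (δ K) (m K) j - cellTail (D i) (δ K) (m K) (j + 1)))
    {B : ℝ} (hB : ∀ K, ∫ v, maxVirtual (φ K) (cells (δ K) (m K) v) ∂Measure.pi D ≤ B) :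
    OPT D ≤ (B : EReal) := by
  have hB0 : 0 ≤ B := (integral_nonneg fun v => maxVirtual_nonneg (hφ0 0) _).trans (hB 0)
  refine iSup_le fun M => iSup_le fun hM => iSup_le fun hIR => ?_
  have hcap : ∀ v, Filter.Tendsto
      (fun K => ENNReal.ofReal (∑ i, M.cappedPay (m K * δ K) i v)) Filter.atTop
      (nhds (ENNReal.ofReal (∑ i, (M.pay v i - M.pay (Function.update v i 0) i)))) := by
    intro v
    refine tendsto_const_nhds.congr' ?_
    have : ∀ᶠ K in Filter.atTop, ∀ i, v i ≤ m K * δ K :=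
      Filter.eventually_all.2 fun i => hm.eventually_ge_atTop (v i)
    filter_upwards [this] with K hK
    congr 1
    refine Finset.sum_congr rfl fun i _ => ?_
    rw [Mechanism.cappedPay, min_eq_left (hK i), Function.update_eq_self]
  have hbound : ∀ K, ∫⁻ v, ENNReal.ofReal (∑ i, M.cappedPay (m K * δ K) i v) ∂Measure.pi D ≤
      ENNReal.ofReal (2 * n * δ K + B) := by
    intro K
    rw [← ofReal_integral_eq_lintegral_ofReal
      (integrable_finsetSum _ fun i _ => hM.integrable_cappedPay D (m K * δ K) i)
      (Filter.Eventually.of_forall fun v =>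
        Finset.sum_nonneg fun i _ => hM.cappedPay_nonneg _ i v)]
    exact ENNReal.ofReal_le_ofReal ((hM.integral_sum_cappedPay_le D (hδ K) (hφ0 K) (hφ K)).trans
      (by gcongr; exact hB K))
  have hlim : Filter.Tendsto (fun K => ENNReal.ofReal (2 * n * δ K + B)) Filter.atTop
      (nhds (ENNReal.ofReal B)) := by
    refine ENNReal.tendsto_ofReal ?_
    have h1 : Filter.Tendsto (fun K => (δ K : ℝ)) Filter.atTop (nhds 0) := by
      simpa using NNReal.tendsto_coe.2 hδ0
    simpa using (h1.const_mul (2 * n : ℝ)).add_const B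
  have hmain : ∫⁻ v, ENNReal.ofReal (∑ i, M.pay v i) ∂Measure.pi D ≤ ENNReal.ofReal B := by
    calc _ ≤ ∫⁻ v, ENNReal.ofReal (∑ i, (M.pay v i - M.pay (Function.update v i 0) i))
            ∂Measure.pi D := by
          refine lintegral_mono fun v => ENNReal.ofReal_le_ofReal (Finset.sum_le_sum fun i _ => ?_)
          linarith [hIR.pay_zero_le v i]
      _ = ∫⁻ v, Filter.liminf (fun K => ENNReal.ofReal (∑ i, M.cappedPay (m K * δ K) i v))
            Filter.atTop ∂Measure.pi D := lintegral_congr fun v => (hcap v).liminf_eq.symm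
      _ ≤ Filter.liminf (fun K => ∫⁻ v, ENNReal.ofReal (∑ i, M.cappedPay (m K * δ K) i v)
            ∂Measure.pi D) Filter.atTop := lintegral_liminf_le fun K =>
          (Finset.measurable_sum _ fun i _ => M.measurable_cappedPay _ i).ennreal_ofReal
      _ ≤ Filter.liminf (fun K => ENNReal.ofReal (2 * n * δ K + B)) Filter.atTop :=
          Filter.liminf_le_liminf (Filter.Eventually.of_forall hbound)
      _ = ENNReal.ofReal B := hlim.liminf_eq
  calc revenue M D ≤ ((∫⁻ v, ENNReal.ofReal (∑ i, M.pay v i) ∂Measure.pi D : ℝ≥0∞) : EReal) :=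
        EReal.sub_le_of_le_add (le_add_of_nonneg_right (EReal.coe_ennreal_nonneg _))
    _ ≤ (ENNReal.ofReal B : EReal) := by exact_mod_cast hmain
    _ = B := by rw [EReal.coe_ennreal_ofReal, max_eq_left hB0]

end UpperBound

/-! ### The virtual value auction -/

variable {n : ℕ}

/-- Buyer `i` wins at the cell profile `c` if its virtual value is positive and the highest one,
ties being broken in favour of the larger index. -/
def Wins (φ : Fin n → ℕ → ℝ) (c : Fin n → ℕ) (i : Fin n) : Prop :=
  0 < φ i (c i) ∧ ∀ j ≠ i, toLex (φ j (c j), j) < toLex (φ i (c i), i)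

/-- The least cell that buyer `i` can report to win against the cells of the others in `c`. The
value is irrelevant if there is none. -/
noncomputable def priceCell (φ : Fin n → ℕ → ℝ) (c : Fin n → ℕ) (i : Fin n) : ℕ :=
  sInf {k | Wins φ (Function.update c i k) i}

theorem Wins.unique {φ : Fin n → ℕ → ℝ} {c : Fin n → ℕ} {i j : Fin n} (hi : Wins φ c i)
    (hj : Wins φ c j) : i = j := by
  by_contra h
  exact lt_asymm (hi.2 j (Ne.symm h)) (hj.2 i h)

theorem wins_update_iff {φ : Fin n → ℕ → ℝ} {c : Fin n → ℕ} {i : Fin n} {k : ℕ} :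
    Wins φ (Function.update c i k) i ↔
      0 < φ i k ∧ ∀ j ≠ i, toLex (φ j (c j), j) < toLex (φ i k, i) := by
  unfold Wins
  rw [Function.update_self]
  exact and_congr_right fun _ => forall₂_congr fun j hj => by rw [Function.update_of_ne hj]

theorem wins_update_mono {φ : Fin n → ℕ → ℝ} {c : Fin n → ℕ} {i : Fin n} {k l : ℕ}
    (h : φ i k ≤ φ i l) (hk : Wins φ (Function.update c i k) i) :
    Wins φ (Function.update c i l) i := by
  rw [wins_update_iff] at hk ⊢
  refine ⟨hk.1.trans_le h, fun j hj => (hk.2 j hj).trans_le ?_⟩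
  rw [Prod.Lex.toLex_le_toLex]
  rcases h.lt_or_eq with h | h
  exacts [Or.inl h, Or.inr ⟨h, le_rfl⟩]

theorem priceCell_update (φ : Fin n → ℕ → ℝ) (c : Fin n → ℕ) (i : Fin n) (k : ℕ) :
    priceCell φ (Function.update c i k) i = priceCell φ c i := by
  simp [priceCell]

theorem wins_update_iff_priceCell_le {φ : Fin n → ℕ → ℝ} {c : Fin n → ℕ} {i : Fin n}
    (hφ : Monotone (φ i)) {l : ℕ} (hl : Wins φ (Function.update c i l) i) (k : ℕ) :
    Wins φ (Function.update c i k) i ↔ priceCell φ c i ≤ k :=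
  ⟨fun h => Nat.sInf_le h, fun h => wins_update_mono (hφ h)
    (Nat.sInf_mem (s := {k | Wins φ (Function.update c i k) i}) ⟨l, hl⟩)⟩

theorem Wins.priceCell_le {φ : Fin n → ℕ → ℝ} {c : Fin n → ℕ} {i : Fin n} (h : Wins φ c i) :
    priceCell φ c i ≤ c i := Nat.sInf_le (by simpa using h)

/-- Just below the price, the virtual value drops. -/
theorem lt_of_lt_priceCell {φ : Fin n → ℕ → ℝ} {c : Fin n → ℕ} {i : Fin n} {l : ℕ}
    (hl : Wins φ (Function.update c i l) i) {k : ℕ}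
    (hk : k < priceCell φ c i) : φ i k < φ i (priceCell φ c i) := by
  have hmem := Nat.sInf_mem (s := {k | Wins φ (Function.update c i k) i}) ⟨l, hl⟩
  by_contra! h
  exact Nat.notMem_of_lt_sInf hk (wins_update_mono h hmem)

open Classical in
/-- The winner has the maximal virtual value, and there is one unless all of them vanish. -/
theorem maxVirtual_le_sum_wins {φ : Fin n → ℕ → ℝ} (hφ : ∀ i j, 0 ≤ φ i j) (c : Fin n → ℕ) :
    maxVirtual φ c ≤ ∑ i, if Wins φ c i then φ i (c i) else 0 := by
  have hterm : ∀ i, 0 ≤ if Wins φ c i then φ i (c i) else 0 := fun i => by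
    split_ifs
    exacts [hφ _ _, le_rfl]
  rcases isEmpty_or_nonempty (Fin n) with hn | hn
  · simp [maxVirtual]
  obtain ⟨i, -, hi⟩ := Finset.exists_max_image Finset.univ
    (fun i => toLex (φ i (c i), i)) Finset.univ_nonempty
  have hle : maxVirtual φ c ≤ φ i (c i) := ciSup_le fun j => by
    have := (Prod.Lex.toLex_le_toLex).1 (hi j (Finset.mem_univ j))
    rcases this with h | h
    exacts [h.le, h.1.le]
  rcases (hφ i (c i)).eq_or_lt with h0 | h0
  · exact hle.trans (h0 ▸ Finset.sum_nonneg fun j _ => hterm j)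
  have hw : Wins φ c i := ⟨h0, fun j hj => (hi j (Finset.mem_univ j)).lt_of_ne fun he =>
    hj (congrArg Prod.snd (toLex.injective he))⟩
  have := Finset.single_le_sum (fun j _ => hterm j) (Finset.mem_univ i)
  rw [if_pos hw] at this
  exact hle.trans this

open Classical in
/-- The auction that sells to the buyer with the highest positive virtual value, at the least grid
value with which that buyer would still have won. -/
noncomputable def auction (δ : ℝ≥0) (m : ℕ) (φ : Fin n → ℕ → ℝ) : Mechanism n where
  alloc b i := if Wins φ (cells δ m b) i then 1 else 0
  pay b i := if Wins φ (cells δ m b) i then priceCell φ (cells δ m b) i * δ else 0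
  measurable_alloc := measurable_comp_cells fun c i => if Wins φ c i then (1 : ℝ) else 0
  measurable_pay := measurable_comp_cells fun c i =>
    if Wins φ c i then (priceCell φ c i * δ : ℝ) else 0
  alloc_nonneg b i := by split_ifs <;> simp
  sum_alloc_le_one b := by
    by_cases h : ∃ i, Wins φ (cells δ m b) i
    · obtain ⟨i, hi⟩ := h
      rw [Finset.sum_eq_single i (fun j _ hj => if_neg fun hw => hj (hw.unique hi)) (by simp)]
      split_ifs
      simp
    · push Not at h
      simp [h]

theorem cells_update {δ : ℝ≥0} {m : ℕ} (b : Fin n → ℝ≥0) (i : Fin n) (y : ℝ≥0) :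
    cells δ m (Function.update b i y) = Function.update (cells δ m b) i (cell δ m y) := by
  ext j
  rcases eq_or_ne j i with rfl | hj
  · simp [cells]
  · simp [cells, hj]

section

variable {δ : ℝ≥0} {m : ℕ} {φ : Fin n → ℕ → ℝ}

theorem auction_IR (hδ : 0 < δ) : (auction δ m φ).IR := by
  intro i b
  simp only [Mechanism.utility, auction]
  split_ifs with h
  · have h1 := ((le_cell_iff hδ).1 h.priceCell_le).2
    have h2 : (priceCell φ (cells δ m b) i : ℝ) * δ ≤ b i := by exact_mod_cast h1
    linarith
  · simp

theorem auction_DSIC (hδ : 0 < δ) (hφ : ∀ i, Monotone (φ i)) : (auction δ m φ).DSIC := by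
  intro i b r
  have hIR := auction_IR (m := m) (φ := φ) hδ i b
  simp only [Mechanism.utility, auction, cells_update, priceCell_update] at hIR ⊢
  by_cases hr : Wins φ (cells δ m (Function.update b i r)) i
  · rw [if_pos hr, if_pos hr]
    rw [cells_update] at hr
    by_cases hb : Wins φ (cells δ m b) i
    · rw [if_pos hb, if_pos hb]
    -- The winning deviation beats the price, which the truthful losing bid does not reach.
    · rw [if_neg hb, if_neg hb]
      have h1 := wins_update_iff_priceCell_le (hφ i) hr
      have h2 : ¬ priceCell φ (cells δ m b) i ≤ cell δ m (b i) := fun h =>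
        hb (by
          have hw := (h1 (cells δ m b i)).2 h
          rwa [Function.update_eq_self] at hw)
      have h3 : priceCell φ (cells δ m b) i ≤ m := ((h1 _).1 hr).trans (cell_le r)
      have h4 : b i ≤ priceCell φ (cells δ m b) i * δ := by
        by_contra! h
        exact h2 ((le_cell_iff hδ).2 ⟨h3, h.le⟩)
      have h5 : (b i : ℝ) ≤ priceCell φ (cells δ m b) i * δ := by exact_mod_cast h4
      linarith
  · rw [if_neg hr, if_neg hr]
    simpa using hIR

open Classical in
/-- Against any bids of the others, the expected payment of a buyer is the expected virtual value
of its allocation, because the price is a point where the ironed revenue is attained. -/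
theorem integral_auction_pay (D : Measure ℝ≥0) [IsProbabilityMeasure D]
    (i : Fin n) (hφ : Monotone (φ i))
    (htight : ∀ k ≤ m, 0 < φ i k → (∀ j < k, φ i j < φ i k) → k * δ * cellTail D δ m k =
      ∑ j ∈ Finset.Ico k (m + 1), φ i j * (cellTail D δ m j - cellTail D δ m (j + 1)))
    (b : Fin n → ℝ≥0) :
    ∫ y, (auction δ m φ).pay (Function.update b i y) i ∂D =
      ∫ y, (if Wins φ (cells δ m (Function.update b i y)) i then
        φ i (cells δ m (Function.update b i y) i) else 0) ∂D := by
  simp only [auction, cells_update, priceCell_update, Function.update_self]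
  set c := cells δ m b
  by_cases h : ∃ l ≤ m, Wins φ (Function.update c i l) i
  · obtain ⟨l, hlm, hl⟩ := h
    have hiff := wins_update_iff_priceCell_le hφ hl
    simp only [hiff]
    rw [integral_cellTail, integral_cell D (φ i)]
    refine htight _ (((hiff l).1 hl).trans hlm) ?_ fun k hk => lt_of_lt_priceCell hl hk
    exact (wins_update_iff.1 ((hiff _).2 le_rfl)).1
  · push Not at h
    simp [h _ (cell_le _)]

/-- The auction is DSIC and IR, so its expected revenue is a lower bound on the optimum. The
distributions need not be those from which `φ` was built, provided that they satisfy the same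
equalities where `φ` jumps up. -/
theorem integral_maxVirtual_le_OPT (D : Fin n → Measure ℝ≥0) [∀ i, IsProbabilityMeasure (D i)]
    (hδ : 0 < δ) (hφ : ∀ i, Monotone (φ i)) (hφ0 : ∀ i j, 0 ≤ φ i j)
    (htight : ∀ i, ∀ k ≤ m, 0 < φ i k → (∀ j < k, φ i j < φ i k) →
      k * δ * cellTail (D i) δ m k = ∑ j ∈ Finset.Ico k (m + 1),
        φ i j * (cellTail (D i) δ m j - cellTail (D i) δ m (j + 1))) :
    ((∫ v, maxVirtual φ (cells δ m v) ∂Measure.pi D : ℝ) : EReal) ≤ OPT D := by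
  classical
  have hpay0 : ∀ b i, 0 ≤ (auction δ m φ).pay b i := fun b i => by
    simp only [auction]
    split_ifs <;> positivity
  have hpi : ∀ i, Integrable (fun v => (auction δ m φ).pay v i) (Measure.pi D) := fun i =>
    integrable_comp_cells D fun c => if Wins φ c i then (priceCell φ c i * δ : ℝ) else 0
  have hwi : ∀ i, Integrable (fun v => if Wins φ (cells δ m v) i then
      φ i (cells δ m v i) else 0) (Measure.pi D) := fun i =>
    integrable_comp_cells D fun c => if Wins φ c i then φ i (c i) else 0
  have hle : ∫ v, maxVirtual φ (cells δ m v) ∂Measure.pi D ≤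
      ∫ v, ∑ i, (auction δ m φ).pay v i ∂Measure.pi D := by
    calc _ ≤ ∫ v, ∑ i, (if Wins φ (cells δ m v) i then φ i (cells δ m v i) else 0)
          ∂Measure.pi D :=
          integral_mono (integrable_comp_cells D _) (integrable_finsetSum _ fun i _ => hwi i)
            fun v => maxVirtual_le_sum_wins hφ0 _
      _ = _ := by
          rw [integral_finsetSum _ fun i _ => hwi i, integral_finsetSum _ fun i _ => hpi i]
          refine Finset.sum_congr rfl fun i _ => ?_
          rw [(integral_pi_update D i (hwi i)).2, (integral_pi_update D i (hpi i)).2]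
          exact integral_congr_ae (Filter.Eventually.of_forall fun b =>
            (integral_auction_pay (D i) i (hφ i) (htight i) b).symm)
  have hrev : revenue (auction δ m φ) D =
      ((∫ v, ∑ i, (auction δ m φ).pay v i ∂Measure.pi D : ℝ) : EReal) := by
    have hs : ∀ v, 0 ≤ ∑ i, (auction δ m φ).pay v i := fun v =>
      Finset.sum_nonneg fun i _ => hpay0 v i
    have hz : ∀ v, ENNReal.ofReal (-∑ i, (auction δ m φ).pay v i) = 0 := fun v =>
      ENNReal.ofReal_of_nonpos (neg_nonpos.2 (hs v))
    rw [revenue, ← ofReal_integral_eq_lintegral_ofReal (integrable_finsetSum _ fun i _ => hpi i)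
      (Filter.Eventually.of_forall hs)]
    simp only [hz, lintegral_zero]
    rw [EReal.coe_ennreal_ofReal, max_eq_left (integral_nonneg hs)]
    simp
  calc _ ≤ revenue (auction δ m φ) D := by
        rw [hrev]
        exact_mod_cast hle
    _ ≤ OPT D := le_iSup_of_le (auction δ m φ) (le_iSup_of_le (auction_DSIC hδ hφ)
        (le_iSup_of_le (auction_IR hδ) le_rfl))

end

/-! ### Ignoring low virtual values -/

section Threshold

variable {δ : ℝ≥0} {m : ℕ}

/-- Ironed virtual values of `D` on the grid: nondecreasing and nonnegative, with tail
expectations that dominate the revenue of every posted grid price and equal it wherever the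
virtual value jumps up. -/
structure IsIroned (D : Measure ℝ≥0) (δ : ℝ≥0) (m : ℕ) (φ : ℕ → ℝ) : Prop where
  mono : Monotone φ
  nonneg : ∀ j, 0 ≤ φ j
  le : ∀ k ≤ m, k * δ * cellTail D δ m k ≤
    ∑ j ∈ Finset.Ico k (m + 1), φ j * (cellTail D δ m j - cellTail D δ m (j + 1))
  tight : ∀ k ≤ m, 0 < φ k → (∀ j < k, φ j < φ k) → k * δ * cellTail D δ m k =
    ∑ j ∈ Finset.Ico k (m + 1), φ j * (cellTail D δ m j - cellTail D δ m (j + 1))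

theorem exists_isIroned (D : Measure ℝ≥0) [IsProbabilityMeasure D] (δ : ℝ≥0) (m : ℕ) :
    ∃ φ, IsIroned D δ m φ := by
  obtain ⟨φ, hmono, h0, -, hle, htight⟩ := exists_ironing (cellTail D δ m)
    (fun k => k * δ * cellTail D δ m k) (cellTail_antitone D) (fun k l hkl he => by
      rw [he]
      have := cellTail_nonneg D (δ := δ) (m := m) l
      gcongr) (m + 1)
  have hz : cellTail D δ m (m + 1) = 0 := cellTail_of_lt D (Nat.lt_succ_self m)
  simp only [hz, mul_zero, sub_zero] at hle htight
  exact ⟨φ, hmono, h0, fun k hk => hle k (by omega), fun k hk => htight k (by omega)⟩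

/-- Virtual values of rank below `r` are rounded down to zero. The rank of buyer `i` with virtual
value `x` is the pair `(x, i)` in the lexicographic order, by which the auction breaks ties. -/
noncomputable def cutoff (φ : Fin n → ℕ → ℝ) (r : ℝ ×ₗ Fin n) (i : Fin n) (j : ℕ) : ℝ :=
  if r ≤ toLex (φ i j, i) then φ i j else 0

/-- The probability that the virtual value of buyer `i` has rank at least `r`. -/
noncomputable def rankProb (D : Fin n → Measure ℝ≥0) (δ : ℝ≥0) (m : ℕ) (φ : Fin n → ℕ → ℝ)
    (r : ℝ ×ₗ Fin n) (i : Fin n) : ℝ :=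
  (D i).real {v | r ≤ toLex (φ i (cell δ m v), i)}

theorem rank_mono {φ : Fin n → ℕ → ℝ} {i : Fin n} {j k : ℕ} (h : φ i j ≤ φ i k) :
    toLex (φ i j, i) ≤ toLex (φ i k, i) := by
  rw [Prod.Lex.toLex_le_toLex]
  rcases h.lt_or_eq with h | h
  exacts [Or.inl h, Or.inr ⟨h, le_rfl⟩]

section Cutoff

variable {φ : Fin n → ℕ → ℝ} {r : ℝ ×ₗ Fin n} {i : Fin n}

theorem cutoff_nonneg (h : ∀ j, 0 ≤ φ i j) (j : ℕ) : 0 ≤ cutoff φ r i j := by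
  unfold cutoff
  split_ifs
  exacts [h j, le_rfl]

theorem le_rank_of_cutoff_pos {j : ℕ} (h : 0 < cutoff φ r i j) : r ≤ toLex (φ i j, i) := by
  by_contra hr
  simp [cutoff, hr] at h

theorem cutoff_mono (hmono : Monotone (φ i)) (h0 : ∀ j, 0 ≤ φ i j) : Monotone (cutoff φ r i) := by
  intro j k hjk
  by_cases hj : r ≤ toLex (φ i j, i)
  · have hk := hj.trans (rank_mono (hmono hjk))
    simpa [cutoff, hj, hk] using hmono hjk
  · simpa [cutoff, hj] using cutoff_nonneg (r := r) h0 k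

theorem cellTail_le_rankProb {D : Fin n → Measure ℝ≥0} [∀ i, IsProbabilityMeasure (D i)]
    (hmono : Monotone (φ i)) {k : ℕ} (h : 0 < cutoff φ r i k) :
    cellTail (D i) δ m k ≤ rankProb D δ m φ r i :=
  measureReal_mono fun _ hv => (le_rank_of_cutoff_pos h).trans (rank_mono (hmono hv))

end Cutoff

/-- Truncation at `θ` does not change the tails of probability at most `θ`. -/
theorem cellTail_truncate (D : Measure ℝ≥0) [IsProbabilityMeasure D] (hδ : 0 < δ) {θ : ℝ}
    (hθ : 0 ≤ θ) {j : ℕ} (hj : cellTail D δ m j ≤ θ) :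
    cellTail (truncate D θ) δ m j = cellTail D δ m j := by
  by_cases hjm : j ≤ m
  · rw [cellTail_eq_quantile _ hδ hjm] at hj ⊢
    rw [cellTail_eq_quantile _ hδ hjm, quantile_truncate D hθ]
    split_ifs with h0
    · exact min_eq_left hj
    · rw [nonpos_iff_eq_zero.1 (not_lt.1 h0), quantile_zero]
  · rw [cellTail_of_lt _ (not_le.1 hjm), cellTail_of_lt _ (not_le.1 hjm)]

/-- A nondecreasing function of the cell has the same law under two distributions that agree on
the tails where it is positive. -/
theorem map_cell_eq (D D' : Measure ℝ≥0) [IsProbabilityMeasure D] [IsProbabilityMeasure D']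
    {ψ : ℕ → ℝ} (hψ : Monotone ψ) (hψ0 : ∀ j, 0 ≤ ψ j)
    (h : ∀ k, 0 < ψ k → cellTail D' δ m k = cellTail D δ m k) :
    D'.map (fun v => ψ (cell δ m v)) = D.map (fun v => ψ (cell δ m v)) := by
  have hmeas : Measurable fun v => ψ (cell δ m v) := measurable_from_top.comp measurable_cell
  have := Measure.isProbabilityMeasure_map (μ := D') hmeas.aemeasurable
  refine Measure.ext_of_Ici _ _ fun a => ?_
  rw [Measure.map_apply hmeas measurableSet_Ici, Measure.map_apply hmeas measurableSet_Ici]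
  by_cases ha : a ≤ 0
  · have : (fun v => ψ (cell δ m v)) ⁻¹' Set.Ici a = Set.univ :=
      Set.eq_univ_of_forall fun v => ha.trans (hψ0 _)
    rw [this, measure_univ, measure_univ]
  by_cases hex : ∃ k, a ≤ ψ k
  · have hpre : (fun v => ψ (cell δ m v)) ⁻¹' Set.Ici a = {v | Nat.find hex ≤ cell δ m v} := by
      ext v
      exact ⟨fun hv => Nat.find_min' hex hv, fun hv => (Nat.find_spec hex).trans (hψ hv)⟩
    rw [hpre]
    exact (measureReal_eq_measureReal_iff (measure_ne_top _ _) (measure_ne_top _ _)).1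
      (h _ ((not_le.1 ha).trans_le (Nat.find_spec hex)))
  · have : (fun v => ψ (cell δ m v)) ⁻¹' Set.Ici a = ∅ := by
      ext v
      simpa using not_le.1 fun h' => hex ⟨_, h'⟩
    rw [this, measure_empty, measure_empty]

theorem integral_maxVirtual_congr {D D' : Fin n → Measure ℝ≥0} [∀ i, IsProbabilityMeasure (D i)]
    [∀ i, IsProbabilityMeasure (D' i)] {φ : Fin n → ℕ → ℝ}
    (h : ∀ i, (D' i).map (fun v => φ i (cell δ m v)) = (D i).map (fun v => φ i (cell δ m v))) :
    ∫ v, maxVirtual φ (cells δ m v) ∂Measure.pi D' =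
      ∫ v, maxVirtual φ (cells δ m v) ∂Measure.pi D := by
  have hmeas : ∀ i, Measurable fun v => φ i (cell δ m v) := fun i =>
    measurable_from_top.comp measurable_cell
  have hmap : ∀ (μ : Fin n → Measure ℝ≥0) [∀ i, IsProbabilityMeasure (μ i)],
      ∫ v, maxVirtual φ (cells δ m v) ∂Measure.pi μ =
        ∫ w, ⨆ i, w i ∂Measure.pi fun i => (μ i).map fun v => φ i (cell δ m v) := by
    intro μ _
    have : ∀ i, IsProbabilityMeasure ((μ i).map fun v => φ i (cell δ m v)) := fun i =>
      Measure.isProbabilityMeasure_map (hmeas i).aemeasurable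
    rw [← Measure.pi_map_pi fun i => (hmeas i).aemeasurable, integral_map]
    · rfl
    · exact (measurable_pi_lambda _ fun i =>
        (hmeas i).comp (measurable_pi_apply i)).aemeasurable
    · exact (Measurable.iSup fun i => measurable_pi_apply i).aestronglyMeasurable
  rw [hmap, hmap]
  simp only [h]

/-- If every threshold is at least the probability of a virtual value of rank `r`, then the
truncated distributions still support the auction that ignores smaller ranks. -/
theorem integral_cutoff_le_OPT_truncate (D : Fin n → Measure ℝ≥0)
    [∀ i, IsProbabilityMeasure (D i)] (hδ : 0 < δ) {φ : Fin n → ℕ → ℝ}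
    (hφ : ∀ i, IsIroned (D i) δ m (φ i)) (r : ℝ ×ₗ Fin n) {θ : Fin n → ℝ}
    (hθ : ∀ i, rankProb D δ m φ r i ≤ θ i) :
    ((∫ v, maxVirtual (cutoff φ r) (cells δ m v) ∂Measure.pi D : ℝ) : EReal) ≤
      OPT fun i => truncate (D i) (θ i) := by
  have hθ0 : ∀ i, 0 ≤ θ i := fun i => measureReal_nonneg.trans (hθ i)
  have htail : ∀ i k, 0 < cutoff φ r i k → ∀ j, k ≤ j →
      cellTail (truncate (D i) (θ i)) δ m j = cellTail (D i) δ m j := fun i k hk j hj =>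
    cellTail_truncate (D i) hδ (hθ0 i) ((cellTail_antitone (D i) hj).trans
      ((cellTail_le_rankProb (hφ i).mono hk).trans (hθ i)))
  have hmono : ∀ i, Monotone (cutoff φ r i) := fun i => cutoff_mono (hφ i).mono (hφ i).nonneg
  have hnn : ∀ i j, 0 ≤ cutoff φ r i j := fun i => cutoff_nonneg (hφ i).nonneg
  rw [← integral_maxVirtual_congr (D' := fun i => truncate (D i) (θ i)) fun i =>
    map_cell_eq (D i) (truncate (D i) (θ i)) (hmono i) (hnn i) fun k hk => htail i k hk k le_rfl]
  refine integral_maxVirtual_le_OPT _ hδ hmono hnn fun i k hkm hk hlt => ?_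
  have hr := le_rank_of_cutoff_pos hk
  have hval : ∀ j, k ≤ j → cutoff φ r i j = φ i j := fun j hj =>
    if_pos (hr.trans (rank_mono ((hφ i).mono hj)))
  have hφk : 0 < φ i k := hval k le_rfl ▸ hk
  rw [htail i k hk k le_rfl, (hφ i).tight k hkm hφk]
  · refine Finset.sum_congr rfl fun j hj => ?_
    have hkj := (Finset.mem_Ico.1 hj).1
    rw [hval j hkj, htail i k hk j hkj, htail i k hk (j + 1) (by omega)]
  · intro j hj
    refine ((hφ i).mono hj.le).lt_of_ne fun he => (hlt j hj).ne ?_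
    simp only [cutoff, he]

theorem le_maxVirtual_cutoff {φ : Fin n → ℕ → ℝ} {r : ℝ ×ₗ Fin n} {c : Fin n → ℕ}
    (h : ∃ i, r ≤ toLex (φ i (c i), i)) :
    maxVirtual φ c ≤ maxVirtual (cutoff φ r) c ∧ (ofLex r).1 ≤ maxVirtual φ c := by
  obtain ⟨i, hi⟩ := h
  have hri := Prod.Lex.monotone_fst_ofLex hi
  have : Nonempty (Fin n) := ⟨i⟩
  have hle : ∀ i, r ≤ toLex (φ i (c i), i) → φ i (c i) ≤ maxVirtual (cutoff φ r) c :=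
    fun i hi => by simpa [cutoff, hi] using le_maxVirtual (cutoff φ r) c i
  refine ⟨ciSup_le fun j => ?_, hri.trans (le_maxVirtual φ c i)⟩
  by_cases hj : r ≤ toLex (φ j (c j), j)
  · exact hle j hj
  · exact (Prod.Lex.monotone_fst_ofLex (not_le.1 hj).le).trans (hri.trans (hle i hi))

theorem measureReal_exists_rank (D : Fin n → Measure ℝ≥0) [∀ i, IsProbabilityMeasure (D i)]
    (φ : Fin n → ℕ → ℝ) (r : ℝ ×ₗ Fin n) :
    (Measure.pi D).real {v | ∃ i, r ≤ toLex (φ i (cells δ m v i), i)} =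
      1 - ∏ i, (1 - rankProb D δ m φ r i) := by
  have hms : ∀ i, MeasurableSet {v | r ≤ toLex (φ i (cell δ m v), i)} := fun i =>
    measurable_cell (t := {j | r ≤ toLex (φ i j, i)}) trivial
  have hcompl : {v : Fin n → ℝ≥0 | ∃ i, r ≤ toLex (φ i (cells δ m v i), i)}ᶜ =
      Set.univ.pi fun i => {v | r ≤ toLex (φ i (cell δ m v), i)}ᶜ := by
    ext v
    simp [cells]
  have hmE : MeasurableSet {v : Fin n → ℝ≥0 | ∃ i, r ≤ toLex (φ i (cells δ m v i), i)} := by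
    rw [← MeasurableSet.compl_iff, hcompl]
    exact MeasurableSet.univ_pi fun i => (hms i).compl
  have h1 := probReal_compl_eq_one_sub (μ := Measure.pi D) hmE
  rw [hcompl, measureReal_def, Measure.pi_pi, ENNReal.toReal_prod] at h1
  have h2 : ∀ i, ((D i) {v | r ≤ toLex (φ i (cell δ m v), i)}ᶜ).toReal =
      1 - rankProb D δ m φ r i := fun i => probReal_compl_eq_one_sub (hms i)
  simp only [h2] at h1
  linarith

/-- The event that some virtual value has rank at least `r` is positively correlated with the
maximal virtual value, so ignoring smaller ranks keeps at least the corresponding fraction. -/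
theorem integral_cutoff_ge (D : Fin n → Measure ℝ≥0) [∀ i, IsProbabilityMeasure (D i)]
    {φ : Fin n → ℕ → ℝ} (hφ0 : ∀ i j, 0 ≤ φ i j) (r : ℝ ×ₗ Fin n) :
    (1 - ∏ i, (1 - rankProb D δ m φ r i)) * ∫ v, maxVirtual φ (cells δ m v) ∂Measure.pi D ≤
      ∫ v, maxVirtual (cutoff φ r) (cells δ m v) ∂Measure.pi D := by
  classical
  rw [← measureReal_exists_rank D φ r]
  set P := (Measure.pi D).real {v | ∃ i, r ≤ toLex (φ i (cells δ m v i), i)} with hP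
  set t := (ofLex r).1
  set e : (Fin n → ℕ) → ℝ := fun c => if ∃ i, r ≤ toLex (φ i (c i), i) then 1 else 0 with he
  have heP : ∫ v, e (cells δ m v) ∂Measure.pi D = P := by
    have hmE : MeasurableSet {v : Fin n → ℝ≥0 | ∃ i, r ≤ toLex (φ i (cells δ m v i), i)} :=
      measurable_cells
        (Set.to_countable {c : Fin n → ℕ | ∃ i, r ≤ toLex (φ i (c i), i)}).measurableSet
    rw [hP, ← integral_indicator_one hmE]
    exact integral_congr_ae (Filter.Eventually.of_forall fun v => by
      simp [he, Set.indicator_apply])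
  have hpt : ∀ c, P * maxVirtual φ c + t * (e c - P) ≤ maxVirtual (cutoff φ r) c := by
    intro c
    have hP1 : P ≤ 1 := measureReal_le_one
    have hP0 : 0 ≤ P := measureReal_nonneg
    by_cases h : ∃ i, r ≤ toLex (φ i (c i), i)
    · obtain ⟨h1, h2⟩ := le_maxVirtual_cutoff h
      simp only [he, if_pos h]
      nlinarith
    · have h1 : maxVirtual φ c ≤ t ∨ maxVirtual φ c = 0 ∧ IsEmpty (Fin n) := by
        rcases isEmpty_or_nonempty (Fin n) with hn | hn
        · exact Or.inr ⟨by simp [maxVirtual], hn⟩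
        · push Not at h
          exact Or.inl (ciSup_le fun i => Prod.Lex.monotone_fst_ofLex (h i).le)
      have h2 : 0 ≤ maxVirtual (cutoff φ r) c :=
        maxVirtual_nonneg (fun i => cutoff_nonneg (hφ0 i)) c
      simp only [he, if_neg h]
      rcases h1 with h1 | ⟨-, hn⟩
      · nlinarith
      · exact (IsEmpty.false (ofLex r).2).elim
  have h1 := integral_mono (μ := Measure.pi D)
    (integrable_comp_cells D (δ := δ) (m := m) fun c => P * maxVirtual φ c + t * (e c - P))
    (integrable_comp_cells D (maxVirtual (cutoff φ r))) fun v => hpt (cells δ m v)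
  have h2 : ∫ v, (P * maxVirtual φ (cells δ m v) + t * (e (cells δ m v) - P)) ∂Measure.pi D =
      P * ∫ v, maxVirtual φ (cells δ m v) ∂Measure.pi D + t * (P - P) := by
    rw [integral_add (integrable_comp_cells D fun c => P * maxVirtual φ c)
      (integrable_comp_cells D fun c => t * (e c - P)), integral_const_mul, integral_const_mul,
      integral_sub (integrable_comp_cells D e) (integrable_const P), heP]
    simp
  rw [h2] at h1
  linarith

/-- There is a rank such that some virtual value reaches it with probability at least `1 - ε`,
while without the buyer of that rank this probability is at most `1 - ε`. -/
theorem exists_rank [NeZero n] (D : Fin n → Measure ℝ≥0) [∀ i, IsProbabilityMeasure (D i)]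
    (δ : ℝ≥0) (m : ℕ) (φ : Fin n → ℕ → ℝ) {ε : ℝ} (hε0 : 0 ≤ ε) (hε1 : ε ≤ 1) :
    ∃ r : ℝ ×ₗ Fin n, ∏ i, (1 - rankProb D δ m φ r i) ≤ ε ∧
      ∃ a, ε ≤ ∏ i ∈ Finset.univ.erase a, (1 - rankProb D δ m φ r i) := by
  classical
  have hp0 : ∀ r i, 0 ≤ 1 - rankProb D δ m φ r i := fun r i => sub_nonneg.2 measureReal_le_one
  have hp1 : ∀ r i, 1 - rankProb D δ m φ r i ≤ 1 := fun r i => sub_le_self _ measureReal_nonneg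
  set S : Finset (ℝ ×ₗ Fin n) := (Finset.univ ×ˢ Finset.range (m + 1)).image
    fun p : Fin n × ℕ => toLex (φ p.1 p.2, p.1) with hS
  have hmem : ∀ i v, toLex (φ i (cell δ m v), i) ∈ S := fun i v =>
    Finset.mem_image.2 ⟨(i, cell δ m v), by simp [cell_le], rfl⟩
  have hSne : S.Nonempty := ⟨_, hmem 0 0⟩
  set A := S.filter fun r => ∏ i, (1 - rankProb D δ m φ r i) ≤ ε with hA
  -- The least rank is always reached.
  have hAne : A.Nonempty := by
    refine ⟨S.min' hSne, Finset.mem_filter.2 ⟨S.min'_mem hSne, ?_⟩⟩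
    rw [Finset.prod_eq_zero (Finset.mem_univ 0)]
    · exact hε0
    · have : {v | S.min' hSne ≤ toLex (φ 0 (cell δ m v), (0 : Fin n))} = Set.univ :=
        Set.eq_univ_of_forall fun v => S.min'_le _ (hmem 0 v)
      rw [rankProb, this, probReal_univ, sub_self]
  set r := A.max' hAne with hr
  have hrA := Finset.mem_filter.1 (A.max'_mem hAne)
  refine ⟨r, hrA.2, (ofLex r).2, ?_⟩
  have hne : ∀ i ∈ Finset.univ.erase (ofLex r).2, ∀ v, r ≠ toLex (φ i (cell δ m v), i) :=
    fun i hi v h => Finset.ne_of_mem_erase hi (by rw [h]; rfl)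
  by_cases hB : (S.filter fun s => r < s).Nonempty
  · -- A buyer of another rank reaches `r` exactly when it reaches the next rank `s`.
    set s := (S.filter fun s => r < s).min' hB with hs
    have hsB := Finset.mem_filter.1 (Finset.min'_mem _ hB)
    have hsε : ε < ∏ i, (1 - rankProb D δ m φ s i) := by
      by_contra! h
      exact absurd (A.le_max' s (Finset.mem_filter.2 ⟨hsB.1, h⟩)) (not_le.2 hsB.2)
    have heq : ∀ i ∈ Finset.univ.erase (ofLex r).2,
        rankProb D δ m φ r i = rankProb D δ m φ s i := by
      intro i hi
      unfold rankProb
      congr 1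
      ext v
      refine ⟨fun h => Finset.min'_le _ _ (Finset.mem_filter.2 ⟨hmem i v, ?_⟩),
        fun h => hsB.2.le.trans h⟩
      exact h.lt_of_ne (hne i hi v)
    rw [Finset.prod_congr rfl fun i hi => by rw [heq i hi]]
    refine hsε.le.trans ?_
    rw [← Finset.mul_prod_erase _ _ (Finset.mem_univ (ofLex r).2)]
    exact mul_le_of_le_one_left (Finset.prod_nonneg fun i _ => hp0 s i) (hp1 s _)
  · refine hε1.trans (Finset.prod_eq_one fun i hi => ?_).ge
    have : {v | r ≤ toLex (φ i (cell δ m v), i)} = ∅ := Set.eq_empty_of_forall_notMem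
      fun v h => hB ⟨_, Finset.mem_filter.2 ⟨hmem i v, lt_of_le_of_ne h (hne i hi v)⟩⟩
    rw [rankProb, this, measureReal_empty, sub_zero]

end Threshold

/-! ### Choice of the thresholds -/

theorem OPT_nonneg (D : Fin n → Measure ℝ≥0) : 0 ≤ OPT D := by
  let M : Mechanism n := ⟨fun _ _ => 0, fun _ _ => 0, measurable_const, measurable_const,
    fun _ _ => le_rfl, fun _ => by simp⟩
  have h1 : M.DSIC := fun i b r => by simp [Mechanism.utility, M]
  have h2 : M.IR := fun i b => by simp [Mechanism.utility, M]
  refine le_iSup_of_le M (le_iSup_of_le h1 (le_iSup_of_le h2 ?_))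
  simp [revenue, M]

/-- A truthful buyer never pays more than its value times its allocation. -/
theorem OPT_le_one (D : Fin n → Measure ℝ≥0) [∀ i, IsProbabilityMeasure (D i)]
    (hD : ∀ i, ∀ᵐ v ∂D i, v ≤ 1) : OPT D ≤ 1 := by
  refine iSup_le fun M => iSup_le fun _ => iSup_le fun hIR => ?_
  have hae : ∀ᵐ v ∂Measure.pi D, ∀ i, v i ≤ 1 := ae_all_iff.2 fun i =>
    Measure.tendsto_eval_ae_ae.eventually (hD i)
  have hle : ∫⁻ v, ENNReal.ofReal (∑ i, M.pay v i) ∂Measure.pi D ≤ 1 := by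
    calc _ ≤ ∫⁻ _, 1 ∂Measure.pi D := by
          refine lintegral_mono_ae (hae.mono fun v hv => ?_)
          rw [← ENNReal.ofReal_one]
          refine ENNReal.ofReal_le_ofReal ((Finset.sum_le_sum fun i _ => ?_).trans
            (M.sum_alloc_le_one v))
          have h1 := hIR i v
          have h2 : (v i : ℝ) * M.alloc v i ≤ 1 * M.alloc v i :=
            mul_le_mul_of_nonneg_right (by exact_mod_cast hv i) (M.alloc_nonneg v i)
          simp only [Mechanism.utility] at h1
          linarith
      _ = 1 := by simp
  calc revenue M D ≤ ((∫⁻ v, ENNReal.ofReal (∑ i, M.pay v i) ∂Measure.pi D : ℝ≥0∞) : EReal) :=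
        EReal.sub_le_of_le_add (le_add_of_nonneg_right (EReal.coe_ennreal_nonneg _))
    _ ≤ 1 := by exact_mod_cast hle

/-- For values in `[0, 1]` the multiplicative guarantee implies the additive one. -/
theorem OPT_sub_le (D : Fin n → Measure ℝ≥0) [∀ i, IsProbabilityMeasure (D i)] {ε : ℝ}
    (hε0 : 0 ≤ ε) {B : EReal} (h : ((1 - ε : ℝ) : EReal) * OPT D ≤ B)
    (hD : ∀ i, ∀ᵐ v ∂D i, v ≤ 1) : OPT D - (ε : EReal) ≤ B := by
  refine le_trans ?_ h
  have h0 := OPT_nonneg D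
  have h1 := OPT_le_one D hD
  induction hx : OPT D with
  | bot => simp
  | top => exact absurd h1 (hx ▸ not_le.2 (EReal.coe_lt_top 1))
  | coe x =>
    rw [hx] at h0 h1
    have h0' : 0 ≤ x := by exact_mod_cast h0
    have h1' : x ≤ 1 := by exact_mod_cast h1
    have : x - ε ≤ (1 - ε) * x := by nlinarith
    exact_mod_cast this

/-- The sum of the quantile thresholds is bounded by the product of the complements, with strict
slack because one coordinate is left out of the product. -/
theorem sum_lt_of_le_prod_erase {ι : Type*} [Fintype ι] [DecidableEq ι] {θ : ι → ℝ} {ε : ℝ}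
    (hε0 : 0 < ε) (hε1 : ε < 1) (h1 : ∀ i, θ i ≤ 1) {a : ι}
    (h : ε ≤ ∏ i ∈ Finset.univ.erase a, (1 - θ i)) :
    ∑ i, θ i < Real.log (1 / ε) + 1 := by
  have hlog : 0 < Real.log (1 / ε) := Real.log_pos (by rw [lt_div_iff₀ hε0]; linarith)
  have hne : ∀ i ∈ Finset.univ.erase a, 1 - θ i ≠ 0 := fun i hi he => by
    rw [Finset.prod_eq_zero hi he] at h
    linarith
  have hpos : ∀ i ∈ Finset.univ.erase a, 0 < 1 - θ i := fun i hi =>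
    (sub_nonneg.2 (h1 i)).lt_of_ne (hne i hi).symm
  have hmain : ∑ i ∈ Finset.univ.erase a, θ i < Real.log (1 / ε) := by
    by_cases hz : ∀ i ∈ Finset.univ.erase a, θ i = 0
    · rwa [Finset.sum_eq_zero hz]
    push Not at hz
    obtain ⟨i, hi, hθi⟩ := hz
    have hlt : ∑ i ∈ Finset.univ.erase a, Real.log (1 - θ i) <
        ∑ i ∈ Finset.univ.erase a, -θ i := by
      refine Finset.sum_lt_sum (fun j hj => ?_) ⟨i, hi, ?_⟩
      · linarith [Real.log_le_sub_one_of_pos (hpos j hj)]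
      · linarith [Real.log_lt_sub_one_of_pos (hpos i hi) fun he => hθi (by linarith)]
    rw [← Real.log_prod hne, Finset.sum_neg_distrib] at hlt
    have := Real.log_le_log hε0 h
    rw [one_div, Real.log_inv]
    linarith
  rw [← Finset.add_sum_erase _ _ (Finset.mem_univ a)]
  linarith [h1 a]

/-- The guarantee for a fixed grid: thresholds that are large enough keep a `1 - ε` fraction of
the expected maximal ironed virtual value. -/
theorem exists_thresholds_of_grid [NeZero n] (D : Fin n → Measure ℝ≥0)
    [∀ i, IsProbabilityMeasure (D i)] {ε : ℝ} (hε0 : 0 ≤ ε) (hε1 : ε ≤ 1) {δ : ℝ≥0} (hδ : 0 < δ)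
    (m : ℕ) {φ : Fin n → ℕ → ℝ} (hφ : ∀ i, IsIroned (D i) δ m (φ i)) :
    ∃ ϑ : Fin n → ℝ, ϑ ∈ Set.Icc 0 1 ∧ (∃ a, ε ≤ ∏ i ∈ Finset.univ.erase a, (1 - ϑ i)) ∧
      ∀ θ : Fin n → ℝ, (∀ i, ϑ i ≤ θ i) →
        (((1 - ε) * ∫ v, maxVirtual φ (cells δ m v) ∂Measure.pi D : ℝ) : EReal) ≤
          OPT fun i => truncate (D i) (θ i) := by
  obtain ⟨r, hr, ha⟩ := exists_rank D δ m φ hε0 hε1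
  refine ⟨rankProb D δ m φ r, ⟨fun i => measureReal_nonneg, fun i => measureReal_le_one⟩, ha,
    fun θ hθ => le_trans ?_ (integral_cutoff_le_OPT_truncate D hδ hφ r hθ)⟩
  refine EReal.coe_le_coe_iff.2 (le_trans ?_
    (integral_cutoff_ge D (fun i => (hφ i).nonneg) r))
  exact mul_le_mul_of_nonneg_right (by linarith)
    (integral_nonneg fun v => maxVirtual_nonneg (fun i => (hφ i).nonneg) _)

/-- The multiplicative guarantee. The thresholds of a sequence of ever finer grids accumulate at a
point, and raising that point slightly covers infinitely many of them. -/
theorem exists_thresholds [NeZero n] (D : Fin n → Measure ℝ≥0)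
    [∀ i, IsProbabilityMeasure (D i)] {ε : ℝ} (hε0 : 0 < ε) (hε1 : ε < 1) :
    ∃ θ : Fin n → ℝ, (∀ i, 0 ≤ θ i ∧ θ i ≤ 1) ∧ ∑ i, θ i ≤ Real.log (1 / ε) + 1 ∧
      ((1 - ε : ℝ) : EReal) * OPT D ≤ OPT fun i => truncate (D i) (θ i) := by
  have hn : (0 : ℝ) < n := by exact_mod_cast Nat.pos_of_ne_zero (NeZero.ne n)
  -- The grid of index `K` has mesh `1 / (K + 1)` and reaches up to `K + 1`.
  set δ : ℕ → ℝ≥0 := fun K => 1 / (K + 1) with hδdef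
  set m : ℕ → ℕ := fun K => (K + 1) ^ 2 with hmdef
  have hδ : ∀ K, 0 < δ K := fun K => by positivity
  have hδ0 : Filter.Tendsto δ Filter.atTop (nhds 0) := by
    rw [← NNReal.tendsto_coe]
    simpa [hδdef] using tendsto_one_div_add_atTop_nhds_zero_nat (𝕜 := ℝ)
  have hmδ : Filter.Tendsto (fun K => m K * δ K) Filter.atTop Filter.atTop := by
    have : ∀ K : ℕ, (m K * δ K : ℝ≥0) = ((K + 1 : ℕ) : ℝ≥0) := fun K => by
      simp only [hδdef, hmdef]
      push_cast
      field_simp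
    simp only [this]
    exact tendsto_natCast_atTop_atTop.comp (Filter.tendsto_add_atTop_nat 1)
  choose φ hφ using fun K i => exists_isIroned (D i) (δ K) (m K)
  choose ϑ hϑ01 hϑ hOPT using fun K =>
    exists_thresholds_of_grid D hε0.le hε1.le (hδ K) (m K) (hφ K)
  set C : Set (Fin n → ℝ) := ⋃ a, Set.Icc 0 1 ∩
    {θ | ε ≤ ∏ i ∈ Finset.univ.erase a, (1 - θ i)} with hC
  have hCc : IsCompact C := isCompact_iUnion fun a => isCompact_Icc.inter_right
    (isClosed_le continuous_const (by fun_prop))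
  obtain ⟨θ, hθC, s, hs, hlim⟩ := hCc.tendsto_subseq (x := ϑ) fun K =>
    Set.mem_iUnion.2 ((hϑ K).imp fun a ha => ⟨hϑ01 K, ha⟩)
  obtain ⟨a, ⟨hθ0, hθ1⟩, hθε⟩ := Set.mem_iUnion.1 hθC
  have hsum := sum_lt_of_le_prod_erase hε0 hε1 hθ1 hθε
  -- The slack lets every threshold exceed the limit, so that it covers almost all of the sequence.
  set η := (Real.log (1 / ε) + 1 - ∑ i, θ i) / n with hη
  have hη0 : 0 < η := div_pos (by linarith) hn
  set θ' : Fin n → ℝ := fun i => min (θ i + η) 1 with hθ'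
  have hev : ∀ᶠ k in Filter.atTop, ∀ i, ϑ (s k) i ≤ θ' i :=
    Filter.eventually_all.2 fun i => by
      have h1 := (tendsto_pi_nhds.1 hlim i).eventually_le_const (lt_add_of_pos_right (θ i) hη0)
      filter_upwards [h1] with k hk
      exact le_min hk ((hϑ01 (s k)).2 i)
  refine ⟨θ', fun i => ⟨le_min (add_nonneg (hθ0 i) hη0.le) zero_le_one, min_le_right _ _⟩, ?_, ?_⟩
  · calc ∑ i, θ' i ≤ ∑ i, (θ i + η) := Finset.sum_le_sum fun i _ => min_le_left _ _
      _ = Real.log (1 / ε) + 1 := by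
        rw [Finset.sum_add_distrib, Finset.sum_const, Finset.card_univ, Fintype.card_fin,
          nsmul_eq_mul, hη, mul_div_cancel₀ _ hn.ne']
        ring
  · obtain ⟨k₀, hk₀⟩ := Filter.eventually_atTop.1 hev
    have hpos : (0 : ℝ) < 1 - ε := sub_pos.2 hε1
    have hB0 := OPT_nonneg fun i => truncate (D i) (θ' i)
    have hgrid := fun k => hOPT (s (k + k₀)) θ' (hk₀ (k + k₀) (Nat.le_add_left _ _))
    induction hB : OPT fun i => truncate (D i) (θ' i) with
    | bot => simp [hB] at hB0
    | top => exact le_top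
    | coe B =>
      simp only [hB, EReal.coe_le_coe_iff] at hgrid
      have hle : OPT D ≤ ((B / (1 - ε) : ℝ) : EReal) := by
        have hs' : Filter.Tendsto (fun k => s (k + k₀)) Filter.atTop Filter.atTop :=
          hs.tendsto_atTop.comp (Filter.tendsto_add_atTop_nat k₀)
        refine OPT_le_of_grids D (fun k => hδ (s (k + k₀))) (hδ0.comp hs') (hmδ.comp hs')
          (φ := fun k => φ (s (k + k₀))) (fun k i => (hφ _ i).nonneg) (fun k i => (hφ _ i).le)
          fun k => ?_
        rw [le_div_iff₀ hpos, mul_comm]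
        exact hgrid k
      calc ((1 - ε : ℝ) : EReal) * OPT D ≤ ((1 - ε : ℝ) : EReal) * ((B / (1 - ε) : ℝ) : EReal) :=
            mul_le_mul_of_nonneg_left hle (by exact_mod_cast hpos.le)
        _ = B := by rw [← EReal.coe_mul, mul_div_cancel₀ _ hpos.ne']

end Auction

theorem mainTheorem4 (n : ℕ) (D : Fin n → MeasureTheory.Measure NNReal)
    [∀ i, MeasureTheory.IsProbabilityMeasure (D i)] (ε : ℝ) (hε0 : 0 < ε) (hε1 : ε ≤ 1) :
    ∃ θ : Fin n → ℝ,
      (∀ i, 0 ≤ θ i ∧ θ i ≤ 1) ∧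
      ∑ i, θ i ≤ Real.log (1 / ε) + 1 ∧
      ((1 - ε : ℝ) : EReal) * Auction.OPT D ≤
        Auction.OPT (fun i => Auction.truncate (D i) (θ i)) ∧
      ((∀ i, ∀ᵐ v ∂D i, v ≤ 1) →
        Auction.OPT D - (ε : EReal) ≤
          Auction.OPT (fun i => Auction.truncate (D i) (θ i))) := by
  suffices h : ∃ θ : Fin n → ℝ, (∀ i, 0 ≤ θ i ∧ θ i ≤ 1) ∧ ∑ i, θ i ≤ Real.log (1 / ε) + 1 ∧
      ((1 - ε : ℝ) : EReal) * Auction.OPT D ≤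
        Auction.OPT (fun i => Auction.truncate (D i) (θ i)) by
    obtain ⟨θ, h01, hsum, hmul⟩ := h
    exact ⟨θ, h01, hsum, hmul, Auction.OPT_sub_le D hε0.le hmul⟩
  have hlog : 0 ≤ Real.log (1 / ε) := Real.log_nonneg (by rw [le_div_iff₀ hε0]; linarith)
  rcases hε1.eq_or_lt with rfl | hε1
  · refine ⟨0, fun i => by simp, ?_, ?_⟩
    · simp
    · simpa using Auction.OPT_nonneg _
  rcases Nat.eq_zero_or_pos n with rfl | hn
  · refine ⟨0, fun i => by simp, ?_, ?_⟩
    · rw [Finset.univ_eq_empty, Finset.sum_empty]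
      linarith
    · rw [Subsingleton.elim (fun i => Auction.truncate (D i) ((0 : Fin 0 → ℝ) i)) D]
      calc _ ≤ (1 : EReal) * Auction.OPT D := by
            refine mul_le_mul_of_nonneg_right ?_ (Auction.OPT_nonneg D)
            exact_mod_cast (by linarith : 1 - ε ≤ 1)
        _ = Auction.OPT D := one_mul _
  · have : NeZero n := ⟨hn.ne'⟩
    exact Auction.exists_thresholds D hε0 hε1
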